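/- Fix an integer $d \ge 3$. Let $h$ be the whole-space log-correlated Gaussian field on $\mathbb{R}^d$: the centered Gaussian random generalized function with $$\operatorname{Cov}[(h,f),(h,g)] = \iint f(dx)\, g(dy) \log\frac{1}{|x-y|}$$ for all $f, g$ of total mass zero, where $f,g$ range over the mean-zero Schwartz functions and, more generally, over the mean-zero finite signed measures with $\iint |\log|x-y||\,|f|(dx)|f|(dy) < \infty$ (and likewise for $g$). It is normalized so that its average over the unit sphere is $0$. For $\varepsilon>0$ let $h_\varepsilon(x)$ be the average of $h$ over the box $x+[-\varepsilon,\varepsilon]^d$. For $\xi \ge 0$ and a nearest-neighbor path $P:\{1,\dots,N\}\to\varepsilon\mathbb{Z}^d$ put $L^{\varepsilon,\xi}_h(P)=\sum_{i=1}^N \varepsilon e^{\xi h_\varepsilon(P(i))}$. Let $D^{\varepsilon,\xi}_h$ be the infimum of $L^{\varepsilon,\xi}_h(P)$ over all such paths $P$ that stay in $[0,1]^d\cap\varepsilon\mathbb{Z}^d$, start in $(\{0\}\times[0,1]^{d-1})\cap\varepsilon\mathbb{Z}^d$ and end in $(\{1\}\times[0,1]^{d-1})\cap\varepsilon\mathbb{Z}^d$.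 Define $$\lambda(\xi)=\lambda(d,\xi) := \sup\Big\{\alpha\in\mathbb{R} : \liminf_{\varepsilon\to0}\mathbb{P}\big[D^{\varepsilon,\xi}_h\le\varepsilon^\alpha\big]=1\Big\},$$ where $\varepsilon\to0$ through the reciprocals of the positive integers. Then for every $\xi\ge0$ this set is nonempty and bounded above, so that $\lambda(\xi)$ is a real number; the function $\xi\mapsto\lambda(\xi)$ is $\sqrt{2d}$-Lipschitz on $[0,\infty)$; and for Lebesgue-a.e. $\xi\ge0$ the derivative $\lambda'(\xi)$ exists and satisfies $$\max\Big\{-\xi,\ \frac1\xi\big(\lambda(\xi)-1\big)\Big\}\le\lambda'(\xi)\le\sqrt{2(d-1)+2\lambda(\xi)+\xi^2}-\xi .$$ -/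

import Mathlib

open MeasureTheory ProbabilityTheory Filter Topology
open scoped ENNReal NNReal

/-- A finite measure `μ` on `ℝ^d` of finite logarithmic energy, that is,
`∬ |log |x - y|| μ(dx) μ(dy) < ∞` with `log 0 = -∞`. As `Real.log 0 = 0`, the value `-∞` on the
diagonal is taken into account by requiring that `μ` has no atoms: the diagonal is then
`μ ⊗ μ`-null, while an atom makes the energy infinite. -/
structure FiniteLogEnergy {d : ℕ} (μ : Measure (EuclideanSpace ℝ (Fin d))) : Prop where
  finite : IsFiniteMeasure μ
  noAtoms : ∀ x, μ {x} = 0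
  integrable : Integrable
    (fun p : EuclideanSpace ℝ (Fin d) × EuclideanSpace ℝ (Fin d) => Real.log ‖p.1 - p.2‖)
    (μ.prod μ)

/-- The mutual logarithmic energy `∬ log (1 / |x - y|) μ(dx) ν(dy)`. -/
noncomputable def logEnergy {d : ℕ} (μ ν : Measure (EuclideanSpace ℝ (Fin d))) : ℝ :=
  ∫ p, Real.log (1 / ‖p.1 - p.2‖) ∂(μ.prod ν)

/-- The uniform probability measure on the Euclidean unit sphere of `ℝ^d`, as a measure on `ℝ^d`. -/
noncomputable def unitSphereMeasure (d : ℕ) : Measure (EuclideanSpace ℝ (Fin d)) :=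
  ((volume : Measure (EuclideanSpace ℝ (Fin d))).toSphere Set.univ)⁻¹ •
    ((volume : Measure (EuclideanSpace ℝ (Fin d))).toSphere.map Subtype.val)

/-- The uniform probability measure on the box `x + [-ε, ε]^d`. -/
noncomputable def boxMeasure {d : ℕ} (ε : ℝ) (x : EuclideanSpace ℝ (Fin d)) :
    Measure (EuclideanSpace ℝ (Fin d)) :=
  cond volume {y | ∀ i, |y i - x i| ≤ ε}

/-- `h` is a whole-space log-correlated Gaussian field (LGF) on `ℝ^d`, normalized so that its
average over the unit sphere vanishes. It is given by its pairings `h μ = (h, μ)` with the finite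
measures `μ` of finite logarithmic energy (the values of `h` at other measures are irrelevant):
a centered Gaussian process, linear in `μ`, such that
`Cov[(h, f), (h, g)] = ∬ log (1 / |x - y|) f(dx) g(dy)` for all differences `f = μ₁ - μ₂`,
`g = ν₁ - ν₂` of total mass zero. A Schwartz function `f` of average zero is such a difference, with
`μ₁` and `μ₂` of densities `f⁺` and `f⁻`. -/
structure IsLGF {d : ℕ} {Ω : Type*} [MeasurableSpace Ω]
    (h : Measure (EuclideanSpace ℝ (Fin d)) → Ω → ℝ) (P : Measure Ω) : Prop where
  gaussian : IsGaussianProcess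
    (fun μ : {μ : Measure (EuclideanSpace ℝ (Fin d)) // FiniteLogEnergy μ} => h μ.1) P
  centered : ∀ μ, FiniteLogEnergy μ → ∫ ω, h μ ω ∂P = 0
  map_add : ∀ μ ν, FiniteLogEnergy μ → FiniteLogEnergy ν →
    ∀ᵐ ω ∂P, h (μ + ν) ω = h μ ω + h ν ω
  map_smul : ∀ (c : ℝ≥0) μ, FiniteLogEnergy μ → ∀ᵐ ω ∂P, h (c • μ) ω = c * h μ ω
  covariance : ∀ μ₁ μ₂ ν₁ ν₂, FiniteLogEnergy μ₁ → FiniteLogEnergy μ₂ →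
    FiniteLogEnergy ν₁ → FiniteLogEnergy ν₂ →
    μ₁ Set.univ = μ₂ Set.univ → ν₁ Set.univ = ν₂ Set.univ →
    cov[fun ω => h μ₁ ω - h μ₂ ω, fun ω => h ν₁ ω - h ν₂ ω; P] =
      logEnergy μ₁ ν₁ - logEnergy μ₁ ν₂ - logEnergy μ₂ ν₁ + logEnergy μ₂ ν₂
  sphere_average : ∀ᵐ ω ∂P, h (unitSphereMeasure d) ω = 0

/-- The point `ε z` of the rescaled lattice `ε ℤ^d`. -/
noncomputable def latticePoint {d : ℕ} (ε : ℝ) (z : Fin d → ℤ) : EuclideanSpace ℝ (Fin d) :=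
  WithLp.toLp 2 (fun i => ε * (z i : ℝ))

/-- The nearest-neighbor graph on `ℤ^d`. The point `ε z` of `ε ℤ^d` is encoded by `z`. -/
def latticeGraph (d : ℕ) : SimpleGraph (Fin d → ℤ) where
  Adj z w := ∑ i, |z i - w i| = 1
  symm := ⟨fun z w hzw => by simpa only [abs_sub_comm] using hzw⟩
  loopless := ⟨fun z hz => by simp at hz⟩

/-- `[0,1]^d ∩ ε ℤ^d`. -/
def latticeCube (d : ℕ) (ε : ℝ) : Set (Fin d → ℤ) :=
  {z | ∀ i, latticePoint ε z i ∈ Set.Icc (0 : ℝ) 1}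

/-- The left boundary `({0} × [0,1]^{d-1}) ∩ ε ℤ^d`. -/
def leftBoundary (d : ℕ) (ε : ℝ) : Set (Fin d → ℤ) :=
  {z ∈ latticeCube d ε | ∀ i : Fin d, i.val = 0 → latticePoint ε z i = 0}

/-- The right boundary `({1} × [0,1]^{d-1}) ∩ ε ℤ^d`. -/
def rightBoundary (d : ℕ) (ε : ℝ) : Set (Fin d → ℤ) :=
  {z ∈ latticeCube d ε | ∀ i : Fin d, i.val = 0 → latticePoint ε z i = 1}

/-- The LFPP length `∑ ε exp (ξ φ(P i))` of a discrete path, the sum running over all its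
vertices (both endpoints included), for vertex values `φ`. -/
noncomputable def lfppLength {d : ℕ} (ε ξ : ℝ) (φ : (Fin d → ℤ) → ℝ) {z w : Fin d → ℤ}
    (p : (latticeGraph d).Walk z w) : ℝ :=
  (p.support.map fun v => ε * Real.exp (ξ * φ v)).sum

/-- The LFPP distance between the sets `A` and `B` along discrete paths that stay in `S`;
it is `∞` if there is no such path. -/
noncomputable def lfppDist {d : ℕ} (ε ξ : ℝ) (φ : (Fin d → ℤ) → ℝ)
    (A B S : Set (Fin d → ℤ)) : ℝ≥0∞ :=
  ⨅ (z ∈ A) (w ∈ B) (p : (latticeGraph d).Walk z w) (_ : ∀ v ∈ p.support, v ∈ S),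
    ENNReal.ofReal (lfppLength ε ξ φ p)

/-- The left-right LFPP distance of `[0,1]^d ∩ ε ℤ^d` for the mollified field
`h_ε(x) = ` average of `h` over `x + [-ε, ε]^d`. -/
noncomputable def lfppCrossing {d : ℕ} {Ω : Type*}
    (h : Measure (EuclideanSpace ℝ (Fin d)) → Ω → ℝ) (ε ξ : ℝ) (ω : Ω) : ℝ≥0∞ :=
  lfppDist ε ξ (fun z => h (boxMeasure ε (latticePoint ε z)) ω)
    (leftBoundary d ε) (rightBoundary d ε) (latticeCube d ε)

/-- The `α ∈ ℝ` such that `liminf_{ε → 0} ℙ[D^{ε,ξ} ≤ ε^α] = 1`, where `D^{ε,ξ}` is the left-right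
distance and `ε` runs through the reciprocals of the positive integers (for other `ε ∈ (0,1)` the
right boundary is empty). -/
def lfppExponentSet {d : ℕ} {Ω : Type*} [MeasurableSpace Ω]
    (h : Measure (EuclideanSpace ℝ (Fin d)) → Ω → ℝ) (P : Measure Ω) (ξ : ℝ) : Set ℝ :=
  {α | liminf (fun n : ℕ =>
    P {ω | lfppCrossing h (1 / (n : ℝ)) ξ ω ≤ ENNReal.ofReal ((1 / (n : ℝ)) ^ α)}) atTop = 1}

/-- The set-to-set distance exponent `λ(d, ξ)`. -/
noncomputable def lfppExponent {d : ℕ} {Ω : Type*} [MeasurableSpace Ω]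
    (h : Measure (EuclideanSpace ℝ (Fin d)) → Ω → ℝ) (P : Measure Ω) (ξ : ℝ) : ℝ :=
  sSup (lfppExponentSet h P ξ)

/-! The box average at a vertex of the cube is a centered Gaussian of variance at most `log n + C`,
where `ε = 1/n`. Subtracting the vanishing unit-sphere average gives a pairing of total mass zero,
whose variance is a combination of logarithmic energies. So `E exp (t h_ε) ≤ K n ^ (t² / 2)`, and by
Markov the sum of `exp (t h_ε)` over the cube is at most `n ^ (d + t² / 2 + δ)` with probability
tending to one.

Four comparisons of lengths at two parameters follow, each turning exponents at one parameter into
exponents at the other.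

Lipschitz bound: with high probability `|h_ε| ≤ c log n` on the cube for every `c > √(2d)`, so
changing `ξ` to `ζ` multiplies each weight by at most `n ^ (c |ζ - ξ|)`. At `ξ = 0` the length
counts vertices; this fixes the exponent there within `[-1, 1]`, and the same comparison makes every
exponent finite.

Bound `(λ - 1) / ξ`: for `q ≥ 1`, `∑ a_i ^ q ≤ (∑ a_i) ^ q`, applied with `q = ζ / ξ`.

Bound `-ξ`: for an independent copy `h'`, `cos θ h + sin θ h'` has the law of `h`. Take `ζ cos θ =
ξ` and a nearly optimal path for `h` at `ξ`. Averaging over `h'` costs a factor `n ^ ((ζ² - ξ²) /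
2)`.

Upper bound: for `ζ < ξ`, split a nearly optimal path at `ξ` according to whether `h_ε ≥ -c log n`.
Above the threshold, passing to `ζ` costs `n ^ (c (ξ - ζ))`; below it, even the sum over the whole
cube is negligible against `n ^ (-λ(ζ))` once `c + ζ` exceeds the square root in the statement.

Lipschitz functions are differentiable a.e., and at such a point the comparisons for `ζ ↓ ξ` bound
the derivative. -/

/-! ### Logarithmic energy from volume growth. -/

/-- Dyadic bound for the positive part of the logarithm. -/
lemma ofReal_log_div_le_tsum {r u : ℝ} (hr : 0 < r) (hu : 0 ≤ u) :
    ENNReal.ofReal (Real.log (r / u)) ≤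
      ∑' k : ℕ, ENNReal.ofReal (Real.log 2) * (if u ≤ r / 2 ^ k then 1 else 0) := by
  rcases le_or_gt (r / u) 1 with h1 | h1
  · rw [ENNReal.ofReal_of_nonpos (Real.log_nonpos (by positivity) h1)]
    exact zero_le
  have hu0 : 0 < u := by
    rcases hu.eq_or_lt with h | h
    · simp [← h] at h1
      linarith
    · exact h
  -- With `2 ^ m ≤ r / u < 2 ^ (m + 1)`, exactly the terms `k = 0, …, m` are nonzero, and they add
  -- up to `(m + 1) log 2`.
  obtain ⟨m, hm1, hm2⟩ := exists_nat_pow_near h1.le (one_lt_two : (1 : ℝ) < 2)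
  refine le_trans ?_ (ENNReal.sum_le_tsum (Finset.range (m + 1)))
  have hterm : ∀ k ∈ Finset.range (m + 1),
      ENNReal.ofReal (Real.log 2) * (if u ≤ r / 2 ^ k then 1 else 0) =
        ENNReal.ofReal (Real.log 2) := by
    intro k hk
    have hk' : k ≤ m := Nat.lt_succ_iff.mp (Finset.mem_range.mp hk)
    have h2 : (2 : ℝ) ^ k ≤ r / u := (pow_le_pow_right₀ one_le_two hk').trans hm1
    rw [if_pos, mul_one]
    rw [le_div_iff₀ hu0] at h2
    rw [le_div_iff₀ (by positivity)]
    linarith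
  rw [Finset.sum_congr rfl hterm, Finset.sum_const, Finset.card_range, nsmul_eq_mul,
    ← ENNReal.ofReal_natCast, ← ENNReal.ofReal_mul (by positivity)]
  apply ENNReal.ofReal_le_ofReal
  calc Real.log (r / u) ≤ Real.log (2 ^ (m + 1)) :=
        Real.log_le_log (by linarith) hm2.le
    _ = ((m + 1 : ℕ) : ℝ) * Real.log 2 := Real.log_pow _ _

lemma lintegral_log_div_le {d : ℕ} {μ : Measure (EuclideanSpace ℝ (Fin d))}
    [IsFiniteMeasure μ] {r : ℝ} (hr : 0 < r) {C : ℝ≥0∞}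
    (hC : ∀ x, ∀ k : ℕ, μ (Metric.closedBall x (r / 2 ^ k)) ≤ C * (2⁻¹) ^ k) :
    ∫⁻ p, ENNReal.ofReal (Real.log (r / ‖p.1 - p.2‖)) ∂(μ.prod μ) ≤
      ENNReal.ofReal (Real.log 2) * (C * 2) * μ Set.univ := by
  rw [lintegral_prod _ (by fun_prop)]
  rw [← lintegral_const]
  refine lintegral_mono fun x => ?_
  calc ∫⁻ y, ENNReal.ofReal (Real.log (r / ‖x - y‖)) ∂μ
      ≤ ∫⁻ y, ∑' k : ℕ, ENNReal.ofReal (Real.log 2) *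
          (Metric.closedBall x (r / 2 ^ k)).indicator 1 y ∂μ := by
        refine lintegral_mono fun y => ?_
        refine (ofReal_log_div_le_tsum hr (norm_nonneg _)).trans_eq ?_
        refine tsum_congr fun k => ?_
        congr 1
        classical
        simp only [Set.indicator_apply, Metric.mem_closedBall, dist_eq_norm, norm_sub_rev y x, Pi.one_apply]
    _ = ∑' k : ℕ, ENNReal.ofReal (Real.log 2) * μ (Metric.closedBall x (r / 2 ^ k)) := by
        rw [lintegral_tsum]
        · refine tsum_congr fun k => ?_
          rw [lintegral_const_mul _ (measurable_one.indicator measurableSet_closedBall),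
            lintegral_indicator_one measurableSet_closedBall]
        · intro k
          exact ((measurable_one.indicator measurableSet_closedBall).const_mul _).aemeasurable
    _ ≤ ∑' k : ℕ, ENNReal.ofReal (Real.log 2) * (C * (2⁻¹) ^ k) :=
        ENNReal.tsum_le_tsum fun k => by gcongr; exact hC x k
    _ = ENNReal.ofReal (Real.log 2) * (C * 2) := by
        rw [ENNReal.tsum_mul_left, ENNReal.tsum_mul_left, ENNReal.tsum_geometric,
          ENNReal.one_sub_inv_two, inv_inv]

lemma abs_log_le_add {r u R : ℝ} (hr : 0 < r) (hu : 0 ≤ u) (huR : u ≤ R) :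
    |Real.log u| ≤ |Real.log r| + R / r + max (Real.log (r / u)) 0 := by
  rcases hu.eq_or_lt with rfl | h
  · simp
    positivity
  have h1 : Real.log (r / u) = Real.log r - Real.log u := Real.log_div hr.ne' h.ne'
  have h2 : Real.log u - Real.log r ≤ R / r := by
    rw [← Real.log_div h.ne' hr.ne']
    refine (Real.log_le_self (by positivity)).trans ?_
    gcongr
  have h3 : 0 ≤ R / r := div_nonneg (hu.trans huR) hr.le
  have h4 := le_max_left (Real.log (r / u)) 0
  have h5 := le_max_right (Real.log (r / u)) 0
  have h6 := neg_abs_le (Real.log r)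
  have h7 := le_abs_self (Real.log r)
  rw [abs_le]
  constructor <;> linarith

/-- Linear decay of the mass of small balls makes the singular part of the logarithm integrable and
excludes atoms; bounded support controls the part at large distances. -/
lemma FiniteLogEnergy.of_closedBall_le {d : ℕ} {μ : Measure (EuclideanSpace ℝ (Fin d))}
    [IsFiniteMeasure μ] {r : ℝ} (hr : 0 < r) {C : ℝ≥0∞} (hCtop : C ≠ ∞)
    (hC : ∀ x, ∀ k : ℕ, μ (Metric.closedBall x (r / 2 ^ k)) ≤ C * (2⁻¹) ^ k)
    {R : ℝ} (hR : ∀ᵐ x ∂μ, ‖x‖ ≤ R) : FiniteLogEnergy μ where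
  finite := inferInstance
  noAtoms x := by
    have h1 : Tendsto (fun k : ℕ => C * (2⁻¹ : ℝ≥0∞) ^ k) atTop (𝓝 0) := by
      have := ENNReal.Tendsto.const_mul (a := C)
        (ENNReal.tendsto_pow_atTop_nhds_zero_of_lt_one
          (ENNReal.inv_lt_one.mpr ENNReal.one_lt_two)) (Or.inr hCtop)
      simpa using this
    refine le_antisymm (ge_of_tendsto_of_frequently h1 (Frequently.of_forall fun k => ?_)) zero_le
    exact (measure_mono (Set.singleton_subset_iff.mpr
      (Metric.mem_closedBall_self (by positivity)))).trans (hC x k)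
  integrable := by
    refine ⟨(Measurable.aestronglyMeasurable (by fun_prop)), ?_⟩
    have hR2 : ∀ᵐ p ∂(μ.prod μ), ‖p.1‖ ≤ R ∧ ‖p.2‖ ≤ R :=
      (Measure.quasiMeasurePreserving_fst.ae hR).and (Measure.quasiMeasurePreserving_snd.ae hR)
    rw [hasFiniteIntegral_iff_enorm]
    calc ∫⁻ p, ‖Real.log ‖p.1 - p.2‖‖ₑ ∂(μ.prod μ)
        ≤ ∫⁻ p, (ENNReal.ofReal (|Real.log r| + (R + R) / r) +
            ENNReal.ofReal (Real.log (r / ‖p.1 - p.2‖))) ∂(μ.prod μ) := by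
          refine lintegral_mono_ae ?_
          filter_upwards [hR2] with p hp
          have h1 : ‖p.1 - p.2‖ ≤ R + R := (norm_sub_le _ _).trans (add_le_add hp.1 hp.2)
          have h2 : 0 ≤ R := (norm_nonneg _).trans hp.1
          rw [Real.enorm_eq_ofReal_abs]
          refine (ENNReal.ofReal_le_ofReal (abs_log_le_add hr (norm_nonneg _) h1)).trans_eq ?_
          rw [ENNReal.ofReal_add (by positivity) (le_max_right _ _)]
          congr 1
          exact ENNReal.coe_inj.mpr (by simp [Real.toNNReal])

      _ < ∞ := by
          rw [lintegral_add_left measurable_const, lintegral_const]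
          refine ENNReal.add_lt_top.mpr ⟨ENNReal.mul_lt_top ENNReal.ofReal_lt_top
            (measure_lt_top _ _), (lintegral_log_div_le hr hC).trans_lt ?_⟩
          exact ENNReal.mul_lt_top (ENNReal.mul_lt_top ENNReal.ofReal_lt_top
            (ENNReal.mul_lt_top hCtop.lt_top (by simp))) (measure_lt_top _ _)

lemma measurableSet_box {d : ℕ} (ε : ℝ) (x : EuclideanSpace ℝ (Fin d)) :
    MeasurableSet {y : EuclideanSpace ℝ (Fin d) | ∀ i, |y i - x i| ≤ ε} := by
  rw [Set.ofPred_forall]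
  exact MeasurableSet.iInter fun i => measurableSet_le (by fun_prop) measurable_const

lemma volume_box {d : ℕ} {ε : ℝ} (x : EuclideanSpace ℝ (Fin d)) :
    volume {y : EuclideanSpace ℝ (Fin d) | ∀ i, |y i - x i| ≤ ε} = ENNReal.ofReal (2 * ε) ^ d := by
  have h := (EuclideanSpace.volume_preserving_symm_measurableEquiv_toLp (Fin d)).measure_preimage
    (s := Set.Icc (fun i => x i - ε) (fun i => x i + ε)) measurableSet_Icc.nullMeasurableSet
  have h2 : {y : EuclideanSpace ℝ (Fin d) | ∀ i, |y i - x i| ≤ ε} =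
      (MeasurableEquiv.toLp 2 (Fin d → ℝ)).symm ⁻¹'
        Set.Icc (fun i => x i - ε) (fun i => x i + ε) := by
    ext y
    simp only [Set.mem_ofPred_eq, Set.mem_preimage, Set.mem_Icc, Pi.le_def, ← forall_and]
    refine forall_congr' fun i => ?_
    rw [abs_le]
    change _ ↔ x i - ε ≤ y i ∧ y i ≤ x i + ε
    constructor <;> rintro ⟨h1, h2⟩ <;> constructor <;> linarith
  rw [h2, h, Real.volume_Icc_pi]
  simp only [add_sub_sub_cancel, Finset.prod_const, Finset.card_univ, Fintype.card_fin, two_mul]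

/-! ### The uniform measure on a box. -/

section box
variable {d : ℕ} {ε : ℝ}

lemma volume_box_ne_zero (hε : 0 < ε) (x : EuclideanSpace ℝ (Fin d)) :
    volume {y : EuclideanSpace ℝ (Fin d) | ∀ i, |y i - x i| ≤ ε} ≠ 0 := by
  rw [volume_box]
  exact pow_ne_zero _ (ENNReal.ofReal_pos.mpr (by positivity)).ne'

lemma isProbabilityMeasure_boxMeasure (hε : 0 < ε) (x : EuclideanSpace ℝ (Fin d)) :
    IsProbabilityMeasure (boxMeasure ε x) := by
  refine cond_isProbabilityMeasure_of_finite (volume_box_ne_zero hε x) ?_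
  rw [volume_box]
  exact ENNReal.pow_ne_top ENNReal.ofReal_ne_top

lemma boxMeasure_closedBall_le (hd : d ≠ 0) (hε : 0 < ε) (x y : EuclideanSpace ℝ (Fin d)) (k : ℕ) :
    boxMeasure ε x (Metric.closedBall y (ε / 2 ^ k)) ≤ 1 * (2⁻¹) ^ k := by
  have h1 : volume (Metric.closedBall y (ε / 2 ^ k)) ≤ ENNReal.ofReal (2 * (ε / 2 ^ k)) ^ d := by
    rw [← volume_box y]
    refine measure_mono fun z hz i => ?_
    rw [Metric.mem_closedBall, dist_eq_norm] at hz
    exact (PiLp.norm_apply_le (z - y) i).trans hz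
  have h2 : ENNReal.ofReal (2 * (ε / 2 ^ k)) = ENNReal.ofReal (2 * ε) * (2⁻¹) ^ k := by
    rw [← mul_div_assoc, div_eq_mul_inv, ENNReal.ofReal_mul (by positivity),
      ENNReal.ofReal_inv_of_pos (by positivity), ENNReal.ofReal_pow (by norm_num), ENNReal.inv_pow]
    simp
  rw [boxMeasure, cond_apply (measurableSet_box ε x), one_mul]
  calc _ ≤ (ENNReal.ofReal (2 * ε) ^ d)⁻¹ * (ENNReal.ofReal (2 * ε) * (2⁻¹) ^ k) ^ d := by
        rw [volume_box, ← h2]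
        gcongr
        exact (measure_mono Set.inter_subset_right).trans h1
    _ = ((2⁻¹) ^ k) ^ d := by
        rw [mul_pow, ← mul_assoc, ENNReal.inv_mul_cancel, one_mul]
        · exact pow_ne_zero _ (ENNReal.ofReal_pos.mpr (by positivity)).ne'
        · exact ENNReal.pow_ne_top ENNReal.ofReal_ne_top
    _ ≤ (2⁻¹) ^ k := pow_le_of_le_one zero_le (pow_le_one₀ zero_le (by simp)) hd

lemma ae_boxMeasure (x : EuclideanSpace ℝ (Fin d)) :
    ∀ᵐ y ∂(boxMeasure ε x), ∀ i, |y i - x i| ≤ ε :=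
  ae_cond_mem (measurableSet_box ε x)

lemma ae_boxMeasure_norm_le (x : EuclideanSpace ℝ (Fin d)) :
    ∀ᵐ y ∂(boxMeasure ε x), ‖y‖ ≤ ‖x‖ + √d * |ε| := by
  filter_upwards [ae_boxMeasure x] with y hy
  have h : ‖y - x‖ ≤ √d * |ε| := by
    rw [EuclideanSpace.norm_eq]
    refine Real.sqrt_le_iff.mpr ⟨by positivity, ?_⟩
    calc ∑ i, ‖(y - x) i‖ ^ 2 ≤ ∑ i : Fin d, ε ^ 2 := by
          refine Finset.sum_le_sum fun i _ => ?_
          rw [← sq_abs ε]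
          exact pow_le_pow_left₀ (norm_nonneg _) ((hy i).trans (le_abs_self _)) 2
      _ = (√d * |ε|) ^ 2 := by
          rw [mul_pow, Real.sq_sqrt (by positivity), sq_abs]
          simp
  calc ‖y‖ = ‖x + (y - x)‖ := by congr 1; abel
    _ ≤ _ := (norm_add_le _ _).trans (by gcongr)

lemma finiteLogEnergy_boxMeasure (hd : d ≠ 0) (hε : 0 < ε) (x : EuclideanSpace ℝ (Fin d)) :
    FiniteLogEnergy (boxMeasure ε x) := by
  have := isProbabilityMeasure_boxMeasure hε x
  exact .of_closedBall_le hε ENNReal.one_ne_top (boxMeasure_closedBall_le hd hε x)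
    (ae_boxMeasure_norm_le x)

end box

/-! ### The uniform measure on the unit sphere. -/

section sphere
variable {d : ℕ}

lemma isProbabilityMeasure_unitSphereMeasure (hd : d ≠ 0) :
    IsProbabilityMeasure (unitSphereMeasure d) := by
  have : Nonempty (Fin d) := Fin.pos_iff_nonempty.mp (Nat.pos_of_ne_zero hd)
  constructor
  rw [unitSphereMeasure, Measure.smul_apply, Measure.map_apply measurable_subtype_coe .univ,
    Set.preimage_univ, smul_eq_mul]
  refine ENNReal.inv_mul_cancel ?_ (measure_ne_top _ _)
  rw [Ne, Measure.measure_univ_eq_zero]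
  exact Measure.toSphere_ne_zero _

lemma ae_unitSphereMeasure_norm_eq (d : ℕ) : ∀ᵐ y ∂(unitSphereMeasure d), ‖y‖ = 1 := by
  refine Measure.ae_smul_measure ?_ _
  rw [ae_map_iff measurable_subtype_coe.aemeasurable
    (measurableSet_eq_fun measurable_norm measurable_const)]
  exact .of_forall fun y => by simp

open scoped Pointwise in
/-- The cone over a spherical cap is covered by balls centred on a segment. -/
lemma Ioo_smul_closedBall_subset {E : Type*} [NormedAddCommGroup E] [NormedSpace ℝ E] (x : E)
    (k : ℕ) :
    Set.Ioo (0 : ℝ) 1 • (Metric.sphere (0 : E) 1 ∩ Metric.closedBall x (1 / 2 ^ k)) ⊆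
      ⋃ j ∈ Finset.range (2 ^ k), Metric.closedBall (((j : ℝ) / 2 ^ k) • x) (2 / 2 ^ k) := by
  rintro _ ⟨t, ht, θ, ⟨hθ, hθx⟩, rfl⟩
  rw [mem_sphere_zero_iff_norm] at hθ
  rw [Metric.mem_closedBall, dist_eq_norm] at hθx
  have h2 : (0 : ℝ) < 2 ^ k := by positivity
  have htk : 0 ≤ t * 2 ^ k := by have := ht.1; positivity
  have hj1 := Nat.floor_le htk
  have hj2 := Nat.lt_floor_add_one (t * 2 ^ k)
  set j := ⌊t * 2 ^ k⌋₊ with hj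
  simp only [Set.mem_iUnion, Finset.mem_range, Metric.mem_closedBall, dist_eq_norm]
  have hjlt : (j : ℝ) < 2 ^ k := hj1.trans_lt (by nlinarith [ht.2])
  refine ⟨j, by exact_mod_cast hjlt, ?_⟩
  calc ‖t • θ - ((j : ℝ) / 2 ^ k) • x‖
      = ‖(t - (j : ℝ) / 2 ^ k) • θ + ((j : ℝ) / 2 ^ k) • (θ - x)‖ := by
        congr 1
        rw [sub_smul, smul_sub]
        abel
    _ ≤ |t - (j : ℝ) / 2 ^ k| * ‖θ‖ + |(j : ℝ) / 2 ^ k| * ‖θ - x‖ := by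
        refine (norm_add_le _ _).trans_eq ?_
        rw [norm_smul, norm_smul, Real.norm_eq_abs, Real.norm_eq_abs]
    _ ≤ 1 / 2 ^ k * 1 + 1 * (1 / 2 ^ k) := by
        gcongr
        · rw [abs_le]
          constructor
          · have : (j : ℝ) / 2 ^ k ≤ t := by rwa [div_le_iff₀ h2]
            have : 0 < 1 / (2 : ℝ) ^ k := by positivity
            linarith
          · rw [sub_le_iff_le_add, ← add_div, le_div_iff₀ h2]
            linarith
        · exact hθ.le
        · rw [abs_of_nonneg (by positivity), div_le_one h2]
          exact hjlt.le
    _ = 2 / 2 ^ k := by ring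

/-- A constant in the volume growth of the uniform measure on the unit sphere. -/
noncomputable def sphereGrowth (d : ℕ) : ℝ≥0∞ :=
  ((volume : Measure (EuclideanSpace ℝ (Fin d))).toSphere Set.univ)⁻¹ *
    (d * (2 ^ d * volume (Metric.ball (0 : EuclideanSpace ℝ (Fin d)) 1)))

lemma sphereGrowth_ne_top (hd : d ≠ 0) : sphereGrowth d ≠ ∞ := by
  have : Nonempty (Fin d) := Fin.pos_iff_nonempty.mp (Nat.pos_of_ne_zero hd)
  refine ENNReal.mul_ne_top (ENNReal.inv_ne_top.mpr ?_) (ENNReal.mul_ne_top (by simp)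
    (ENNReal.mul_ne_top (by simp) measure_ball_lt_top.ne))
  rw [Ne, Measure.measure_univ_eq_zero]
  exact Measure.toSphere_ne_zero _

/-- `toSphere` measures a cap by `d` times the volume of its cone. The `2 ^ k` covering balls of
radius `2 / 2 ^ k` have total volume of order `2 ^ (k - k d)`, which is at most `2 ^ (-k)` because
`d ≥ 2`. -/
lemma unitSphereMeasure_closedBall_le (hd : 2 ≤ d) (x : EuclideanSpace ℝ (Fin d)) (k : ℕ) :
    unitSphereMeasure d (Metric.closedBall x (1 / 2 ^ k)) ≤ sphereGrowth d * (2⁻¹) ^ k := by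
  have : Nonempty (Fin d) := Fin.pos_iff_nonempty.mp (by omega)
  have hm : MeasurableSet ((Subtype.val : Metric.sphere (0 : EuclideanSpace ℝ (Fin d)) 1 → _) ⁻¹'
      Metric.closedBall x (1 / 2 ^ k)) :=
    measurable_subtype_coe measurableSet_closedBall
  rw [unitSphereMeasure, Measure.smul_apply,
    Measure.map_apply measurable_subtype_coe measurableSet_closedBall,
    Measure.toSphere_apply' _ hm, Subtype.image_preimage_coe, smul_eq_mul, sphereGrowth, mul_assoc,
    mul_assoc, finrank_euclideanSpace_fin, mul_assoc]
  gcongr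
  calc _ ≤ ∑ j ∈ Finset.range (2 ^ k),
        volume (Metric.closedBall (((j : ℝ) / 2 ^ k) • x) (2 / 2 ^ k)) :=
        (measure_mono (Ioo_smul_closedBall_subset x k)).trans (measure_biUnion_finset_le _ _)
    _ = 2 ^ k * ((2 * (2⁻¹) ^ k) ^ d *
          volume (Metric.ball (0 : EuclideanSpace ℝ (Fin d)) 1)) := by
        have h2 : ENNReal.ofReal (2 / 2 ^ k) = 2 * (2⁻¹) ^ k := by
          rw [div_eq_mul_inv, ENNReal.ofReal_mul (by positivity),
            ENNReal.ofReal_inv_of_pos (by positivity), ENNReal.ofReal_pow (by norm_num),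
            ENNReal.inv_pow]
          simp
        simp only [Measure.addHaar_closedBall volume _ (by positivity : (0 : ℝ) ≤ 2 / 2 ^ k),
          finrank_euclideanSpace_fin, Finset.sum_const, Finset.card_range, nsmul_eq_mul,
          ENNReal.ofReal_pow (by positivity : (0 : ℝ) ≤ 2 / 2 ^ k), h2]
        push_cast
        rfl
    _ ≤ 2 ^ k * ((2 ^ d * ((2⁻¹) ^ k) ^ 2) *
          volume (Metric.ball (0 : EuclideanSpace ℝ (Fin d)) 1)) := by
        rw [mul_pow]
        gcongr 2 ^ k * ((2 ^ d * ?_) * _)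
        exact pow_le_pow_of_le_one zero_le (pow_le_one₀ zero_le (by simp)) hd
    _ = (2 ^ k * (2⁻¹) ^ k) * (2 ^ d * volume (Metric.ball (0 : EuclideanSpace ℝ (Fin d)) 1) *
          (2⁻¹) ^ k) := by ring
    _ = _ := by
        rw [← mul_pow, ENNReal.mul_inv_cancel two_ne_zero ENNReal.ofNat_ne_top, one_pow, one_mul,
          mul_assoc]

lemma finiteLogEnergy_unitSphereMeasure (hd : 2 ≤ d) : FiniteLogEnergy (unitSphereMeasure d) := by
  have hd0 : d ≠ 0 := by omega
  have := isProbabilityMeasure_unitSphereMeasure hd0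
  exact .of_closedBall_le one_pos (sphereGrowth_ne_top hd0) (unitSphereMeasure_closedBall_le hd)
    ((ae_unitSphereMeasure_norm_eq d).mono fun _ h => h.le)

end sphere

/-! ### Variance and exponential moments of the box averages. -/

lemma integral_le_toReal_lintegral_ofReal {α : Type*} [MeasurableSpace α] {μ : Measure α}
    (f : α → ℝ) :
    ∫ a, f a ∂μ ≤ (∫⁻ a, ENNReal.ofReal (f a) ∂μ).toReal := by
  by_cases hi : Integrable f μ
  · rw [integral_eq_lintegral_pos_part_sub_lintegral_neg_part hi]
    exact sub_le_self _ ENNReal.toReal_nonneg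
  · rw [integral_undef hi]
    exact ENNReal.toReal_nonneg

section
variable {d : ℕ}

lemma logEnergy_boxMeasure_le (hd : d ≠ 0) {ε : ℝ} (hε : 0 < ε) (hε1 : ε ≤ 1)
    (x : EuclideanSpace ℝ (Fin d)) :
    logEnergy (boxMeasure ε x) (boxMeasure ε x) ≤ -Real.log ε + 2 * Real.log 2 := by
  have := isProbabilityMeasure_boxMeasure hε x
  have hfin := finiteLogEnergy_boxMeasure hd hε x
  have hint : Integrable (fun p : EuclideanSpace ℝ (Fin d) × EuclideanSpace ℝ (Fin d) =>
      Real.log (1 / ‖p.1 - p.2‖)) ((boxMeasure ε x).prod (boxMeasure ε x)) := by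
    simp only [one_div, Real.log_inv]
    exact hfin.integrable.neg
  have hle : ∫⁻ p, ENNReal.ofReal (Real.log (1 / ‖p.1 - p.2‖) - -Real.log ε)
      ∂((boxMeasure ε x).prod (boxMeasure ε x)) ≤ ENNReal.ofReal (2 * Real.log 2) := by
    refine (lintegral_mono fun p => ENNReal.ofReal_le_ofReal
      (show _ ≤ Real.log (ε / ‖p.1 - p.2‖) from ?_)).trans
      ((lintegral_log_div_le hε (boxMeasure_closedBall_le hd hε x)).trans_eq ?_)
    -- On the diagonal both logarithms of quotients by zero are `0`, so the inequality reads `log ε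
    -- ≤ 0` and uses `ε ≤ 1`.
    · rcases eq_or_ne ‖p.1 - p.2‖ 0 with h | h
      · simpa [h] using Real.log_nonpos hε.le hε1
      · rw [Real.log_div one_ne_zero h, Real.log_div hε.ne' h, Real.log_one]
        linarith
    · rw [measure_univ, mul_one, one_mul, mul_comm, ENNReal.ofReal_mul zero_le_two]
      simp
  have h1 := integral_le_toReal_lintegral_ofReal (μ := (boxMeasure ε x).prod (boxMeasure ε x))
    (fun p => Real.log (1 / ‖p.1 - p.2‖) - -Real.log ε)
  have h2 := ENNReal.toReal_mono ENNReal.ofReal_ne_top hle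
  rw [ENNReal.toReal_ofReal (by positivity)] at h2
  rw [integral_sub hint (integrable_const _), integral_const, probReal_univ, one_smul] at h1
  unfold logEnergy
  linarith

/-- Only an upper bound on distances matters. The condition `1 ≤ R + S` makes the bound nonnegative,
which covers the values `0` taken by `Real.log 0` and by a non-integrable integral. -/
lemma neg_logEnergy_le {μ ν : Measure (EuclideanSpace ℝ (Fin d))} [IsProbabilityMeasure μ]
    [IsProbabilityMeasure ν] {R S : ℝ} (hμ : ∀ᵐ x ∂μ, ‖x‖ ≤ R) (hν : ∀ᵐ x ∂ν, ‖x‖ ≤ S)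
    (hRS : 1 ≤ R + S) :
    -logEnergy μ ν ≤ Real.log (R + S) := by
  unfold logEnergy
  rw [← integral_neg]
  have hle : ∀ᵐ p ∂(μ.prod ν), -Real.log (1 / ‖p.1 - p.2‖) ≤ Real.log (R + S) := by
    filter_upwards [Measure.quasiMeasurePreserving_fst.ae hμ,
      Measure.quasiMeasurePreserving_snd.ae hν] with p h1 h2
    rw [one_div, Real.log_inv, neg_neg]
    have h3 : ‖p.1 - p.2‖ ≤ R + S := (norm_sub_le _ _).trans (add_le_add h1 h2)
    rcases (norm_nonneg (p.1 - p.2)).eq_or_lt with h | h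
    · rw [← h, Real.log_zero]
      exact Real.log_nonneg hRS
    · exact Real.log_le_log h h3
  by_cases hi : Integrable (fun p : EuclideanSpace ℝ (Fin d) × EuclideanSpace ℝ (Fin d) =>
      -Real.log (1 / ‖p.1 - p.2‖)) (μ.prod ν)
  · calc _ ≤ ∫ _, Real.log (R + S) ∂(μ.prod ν) := integral_mono_ae hi (integrable_const _) hle
      _ = _ := by simp
  · rw [integral_undef hi]
    exact Real.log_nonneg hRS

lemma norm_latticePoint_le {ε : ℝ} {z : Fin d → ℤ} (hz : z ∈ latticeCube d ε) :
    ‖latticePoint ε z‖ ≤ √d := by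
  rw [EuclideanSpace.norm_eq]
  apply Real.sqrt_le_sqrt
  calc ∑ i, ‖latticePoint ε z i‖ ^ 2 ≤ ∑ i : Fin d, 1 := by
        refine Finset.sum_le_sum fun i _ => ?_
        have := hz i
        rw [Real.norm_of_nonneg this.1]
        exact pow_le_one₀ this.1 this.2
    _ = d := by simp

variable {Ω : Type*} [MeasurableSpace Ω] {P : Measure Ω}
  {h : Measure (EuclideanSpace ℝ (Fin d)) → Ω → ℝ}

lemma IsLGF.hasGaussianLaw (hh : IsLGF h P) {μ : Measure (EuclideanSpace ℝ (Fin d))}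
    (hμ : FiniteLogEnergy μ) : HasGaussianLaw (h μ) P :=
  hh.gaussian.hasGaussianLaw_eval ⟨μ, hμ⟩

/-- The covariance is prescribed for total mass zero only; `h μ` agrees almost surely with its
difference to the vanishing sphere average. -/
lemma IsLGF.variance_eq (hd : 2 ≤ d) (hh : IsLGF h P)
    {μ : Measure (EuclideanSpace ℝ (Fin d))} [IsProbabilityMeasure μ] (hμ : FiniteLogEnergy μ) :
    Var[h μ; P] = logEnergy μ μ - logEnergy μ (unitSphereMeasure d) -
      logEnergy (unitSphereMeasure d) μ +
      logEnergy (unitSphereMeasure d) (unitSphereMeasure d) := by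
  have := isProbabilityMeasure_unitSphereMeasure (d := d) (by omega)
  have hs := finiteLogEnergy_unitSphereMeasure hd
  have hm : μ Set.univ = unitSphereMeasure d Set.univ := by simp
  rw [← hh.covariance _ _ _ _ hμ hs hμ hs hm hm, covariance_self]
  · refine variance_congr ?_
    filter_upwards [hh.sphere_average] with ω hω
    rw [hω, sub_zero]
  · exact (hh.hasGaussianLaw hμ).aemeasurable.sub (hh.hasGaussianLaw hs).aemeasurable

/-- The value at the vertex `z` of the field averaged over boxes of side length `2 / n`. -/
noncomputable def boxField (h : Measure (EuclideanSpace ℝ (Fin d)) → Ω → ℝ) (n : ℕ)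
    (z : Fin d → ℤ) (ω : Ω) : ℝ :=
  h (boxMeasure (1 / (n : ℝ)) (latticePoint (1 / (n : ℝ)) z)) ω

lemma IsLGF.exists_variance_boxField_le (hd : 2 ≤ d) (hh : IsLGF h P) :
    ∃ C : ℝ, ∀ n : ℕ, n ≠ 0 → ∀ z ∈ latticeCube d (1 / (n : ℝ)),
      Var[boxField h n z; P] ≤ Real.log n + C := by
  refine ⟨2 * Real.log 2 + 2 * Real.log (2 * √d + 1) +
    logEnergy (unitSphereMeasure d) (unitSphereMeasure d), fun n hn z hz => ?_⟩
  have hd0 : d ≠ 0 := by omega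
  have hε : 0 < 1 / (n : ℝ) := by positivity
  have hε1 : 1 / (n : ℝ) ≤ 1 := by
    rw [div_le_one (by positivity)]
    exact_mod_cast Nat.one_le_iff_ne_zero.mpr hn
  have := isProbabilityMeasure_unitSphereMeasure hd0
  have := isProbabilityMeasure_boxMeasure hε (latticePoint (1 / (n : ℝ)) z)
  have h1 := logEnergy_boxMeasure_le hd0 hε hε1 (latticePoint (1 / (n : ℝ)) z)
  have hb : ∀ᵐ x ∂(boxMeasure (1 / (n : ℝ)) (latticePoint (1 / (n : ℝ)) z)), ‖x‖ ≤ 2 * √d := by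
    filter_upwards [ae_boxMeasure_norm_le (ε := 1 / (n : ℝ)) (latticePoint (1 / (n : ℝ)) z)]
      with x hx
    rw [abs_of_pos hε] at hx
    nlinarith [norm_latticePoint_le hz, Real.sqrt_nonneg d]
  have hs : ∀ᵐ x ∂(unitSphereMeasure d), ‖x‖ ≤ 1 :=
    (ae_unitSphereMeasure_norm_eq d).mono fun _ h => h.le
  have h2 := neg_logEnergy_le hb hs (by linarith [Real.sqrt_nonneg d])
  have h3 := neg_logEnergy_le hs hb (by linarith [Real.sqrt_nonneg d])
  rw [add_comm 1] at h3
  have hv := hh.variance_eq hd (finiteLogEnergy_boxMeasure hd0 hε (latticePoint (1 / (n : ℝ)) z))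
  rw [one_div, Real.log_inv, neg_neg] at h1
  rw [show boxField h n z = h (boxMeasure (1 / (n : ℝ)) (latticePoint (1 / (n : ℝ)) z)) from rfl,
    hv]
  simp only [one_div] at *
  linarith

lemma IsLGF.hasGaussianLaw_boxField (hd : d ≠ 0) (hh : IsLGF h P) {n : ℕ} (hn : n ≠ 0)
    (z : Fin d → ℤ) : HasGaussianLaw (boxField h n z) P :=
  hh.hasGaussianLaw (finiteLogEnergy_boxMeasure hd (by positivity) _)

lemma IsLGF.exists_lintegral_exp_boxField_le (hd : 2 ≤ d) (hh : IsLGF h P) (t : ℝ) :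
    ∃ K : ℝ, 0 < K ∧ ∀ n : ℕ, n ≠ 0 → ∀ z ∈ latticeCube d (1 / (n : ℝ)),
      ∫⁻ ω, ENNReal.ofReal (Real.exp (t * boxField h n z ω)) ∂P ≤
        ENNReal.ofReal (K * (n : ℝ) ^ (t ^ 2 / 2)) := by
  obtain ⟨C, hC⟩ := hh.exists_variance_boxField_le hd
  have hd0 : d ≠ 0 := by omega
  refine ⟨Real.exp (C * t ^ 2 / 2), Real.exp_pos _, fun n hn z hz => ?_⟩
  have hg := hh.hasGaussianLaw_boxField hd0 hn z
  have hmap := hg.map_eq_gaussianReal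
  have hmean : P[boxField h n z] = 0 :=
    hh.centered _ (finiteLogEnergy_boxMeasure hd0 (by positivity) _)
  rw [hmean] at hmap
  have hint : Integrable (fun ω => Real.exp (t * boxField h n z ω)) P := by
    have := integrable_exp_mul_gaussianReal (μ := 0) (v := Var[boxField h n z; P].toNNReal) t
    rw [← hmap] at this
    exact this.comp_aemeasurable hg.aemeasurable
  rw [← ofReal_integral_eq_lintegral_ofReal hint (.of_forall fun _ => (Real.exp_pos _).le)]
  apply ENNReal.ofReal_le_ofReal
  have hmgf := mgf_gaussianReal hmap t
  rw [mgf, Real.coe_toNNReal _ (variance_nonneg _ _)] at hmgf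
  rw [hmgf, Real.rpow_def_of_pos (by positivity), ← Real.exp_add]
  apply Real.exp_le_exp.mpr
  nlinarith [hC n hn z hz, sq_nonneg t]

end

/-! ### Deterministic estimates for path lengths. -/

section paths
variable {d : ℕ}

lemma lfppDist_lt_iff {ε ξ : ℝ} {φ : (Fin d → ℤ) → ℝ} {A B S : Set (Fin d → ℤ)} {a : ℝ≥0∞} :
    lfppDist ε ξ φ A B S < a ↔ ∃ z ∈ A, ∃ w ∈ B, ∃ p : (latticeGraph d).Walk z w,
      (∀ v ∈ p.support, v ∈ S) ∧ ENNReal.ofReal (lfppLength ε ξ φ p) < a := by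
  simp only [lfppDist, iInf_lt_iff, exists_prop]

lemma lfppDist_le_of_walk {ε ξ : ℝ} {φ : (Fin d → ℤ) → ℝ} {A B S : Set (Fin d → ℤ)}
    {z w : Fin d → ℤ} (hz : z ∈ A) (hw : w ∈ B) (p : (latticeGraph d).Walk z w)
    (hp : ∀ v ∈ p.support, v ∈ S) :
    lfppDist ε ξ φ A B S ≤ ENNReal.ofReal (lfppLength ε ξ φ p) :=
  iInf₂_le_of_le z hz (iInf₂_le_of_le w hw (iInf₂_le p hp))

/-- Self-avoiding paths visit each vertex once, so their lengths can be compared with sums over the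
cube. -/
lemma lfppLength_bypass_le {ε ξ : ℝ} (hε : 0 ≤ ε) (φ : (Fin d → ℤ) → ℝ) {z w : Fin d → ℤ}
    (p : (latticeGraph d).Walk z w) :
    lfppLength ε ξ φ p.bypass ≤ lfppLength ε ξ φ p := by
  obtain ⟨l, hl, hs⟩ := List.subperm_of_subset p.bypass_isPath.support_nodup
    p.support_bypass_subset_support
  unfold lfppLength
  rw [← (hl.map _).sum_eq]
  refine (hs.map _).sum_le_sum fun x hx => ?_
  obtain ⟨v, -, rfl⟩ := List.mem_map.mp hx
  positivity

lemma lfppLength_eq_sum {ε ξ : ℝ} (φ : (Fin d → ℤ) → ℝ) {z w : Fin d → ℤ}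
    {p : (latticeGraph d).Walk z w} (hp : p.IsPath) :
    lfppLength ε ξ φ p = ∑ v ∈ p.support.toFinset, ε * Real.exp (ξ * φ v) := by
  rw [lfppLength, List.sum_toFinset _ hp.support_nodup]

lemma lfppLength_le_mul {ε ξ ζ c : ℝ} {φ ψ : (Fin d → ℤ) → ℝ} {z w : Fin d → ℤ}
    {p : (latticeGraph d).Walk z w}
    (hp : ∀ v ∈ p.support, ε * Real.exp (ζ * ψ v) ≤ c * (ε * Real.exp (ξ * φ v))) :
    lfppLength ε ζ ψ p ≤ c * lfppLength ε ξ φ p := by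
  unfold lfppLength
  rw [← List.sum_map_mul_left]
  exact List.sum_le_sum hp

lemma List.sum_map_rpow_le {α : Type*} {q : ℝ} (hq : 1 ≤ q) {f : α → ℝ} (hf : ∀ a, 0 ≤ f a)
    (l : List α) : (l.map fun a => f a ^ q).sum ≤ (l.map f).sum ^ q := by
  induction l with
  | nil => simp [Real.zero_rpow (by linarith : q ≠ 0)]
  | cons a l ih =>
    simp only [List.map_cons, List.sum_cons]
    have hl : 0 ≤ (l.map f).sum := List.sum_nonneg fun x hx => by
      obtain ⟨b, -, rfl⟩ := List.mem_map.mp hx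
      exact hf b
    exact (add_le_add le_rfl ih).trans (Real.add_rpow_le_rpow_add (hf a) hl hq)

lemma lfppLength_le_rpow {ε ξ q : ℝ} (hε : 0 < ε) (hq : 1 ≤ q) (φ : (Fin d → ℤ) → ℝ)
    {z w : Fin d → ℤ} (p : (latticeGraph d).Walk z w) :
    lfppLength ε (q * ξ) φ p ≤ ε * (lfppLength ε ξ φ p / ε) ^ q := by
  unfold lfppLength
  rw [List.sum_map_mul_left, List.sum_map_mul_left, mul_div_cancel_left₀ _ hε.ne']
  gcongr
  refine le_trans (le_of_eq ?_)
    (List.sum_map_rpow_le hq (fun v => (Real.exp_pos (ξ * φ v)).le) p.support)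
  congr 2
  ext v
  rw [← Real.exp_mul]
  ring_nf

/-- The vertices of the cube `[0, n]^d`. -/
noncomputable def cubeFinset (d n : ℕ) : Finset (Fin d → ℤ) := Fintype.piFinset fun _ => Finset.Icc 0 (n : ℤ)

lemma mem_latticeCube_iff {n : ℕ} (hn : n ≠ 0) {z : Fin d → ℤ} :
    z ∈ latticeCube d (1 / (n : ℝ)) ↔ z ∈ cubeFinset d n := by
  have hn' : (0 : ℝ) < n := by positivity
  simp only [latticeCube, cubeFinset, Fintype.mem_piFinset, Finset.mem_Icc, Set.mem_Icc]
  refine forall_congr' fun i => ?_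
  change 0 ≤ 1 / (n : ℝ) * z i ∧ 1 / (n : ℝ) * z i ≤ 1 ↔ _
  rw [one_div_mul_eq_div, div_le_one hn']
  refine and_congr ?_ (by exact_mod_cast Iff.rfl)
  rw [le_div_iff₀ hn', zero_mul]
  exact_mod_cast Iff.rfl

lemma card_cubeFinset_le {n : ℕ} (hn : n ≠ 0) :
    ((cubeFinset d n).card : ℝ) ≤ 2 ^ d * (n : ℝ) ^ (d : ℝ) := by
  have h : (cubeFinset d n).card = (n + 1) ^ d := by
    simp [cubeFinset]
  rw [h, Real.rpow_natCast, ← mul_pow]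
  push_cast
  gcongr
  have : (1 : ℝ) ≤ n := by exact_mod_cast Nat.one_le_iff_ne_zero.mpr hn
  linarith

end paths

/-! ### Events of high probability. -/

lemma eventually_le_natCast_rpow (C : ℝ) {δ : ℝ} (hδ : 0 < δ) :
    ∀ᶠ n : ℕ in atTop, C ≤ (n : ℝ) ^ δ :=
  ((tendsto_rpow_atTop hδ).comp tendsto_natCast_atTop_atTop).eventually_ge_atTop C

lemma tendsto_ofReal_mul_rpow_neg (C : ℝ) {δ : ℝ} (hδ : 0 < δ) :
    Tendsto (fun n : ℕ => ENNReal.ofReal (C * (n : ℝ) ^ (-δ))) atTop (𝓝 0) := by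
  have h := ((tendsto_rpow_neg_atTop hδ).comp tendsto_natCast_atTop_atTop).const_mul C
  rw [mul_zero] at h
  simpa using ENNReal.tendsto_ofReal h

section events
variable {d : ℕ} {Ω : Type*} [MeasurableSpace Ω] {P : Measure Ω}
  {h : Measure (EuclideanSpace ℝ (Fin d)) → Ω → ℝ}

lemma mem_lfppExponentSet_iff [IsProbabilityMeasure P] {ξ α : ℝ} :
    α ∈ lfppExponentSet h P ξ ↔ Tendsto (fun n : ℕ =>
      P {ω | lfppCrossing h (1 / (n : ℝ)) ξ ω ≤ ENNReal.ofReal ((1 / (n : ℝ)) ^ α)})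
      atTop (𝓝 1) := by
  refine ⟨fun hα => ?_, fun hα => hα.liminf_eq⟩
  refine tendsto_of_le_liminf_of_limsup_le (le_of_eq (Eq.symm hα)) ?_
  exact limsup_le_of_le (h := .of_forall fun n => prob_le_one)

/-- The sets need not be measurable: only monotonicity and subadditivity of the outer measure enter.
-/
lemma tendsto_measure_one_of_inter_subset [IsProbabilityMeasure P] {A B C : ℕ → Set Ω}
    (hA : Tendsto (fun n => P (A n)) atTop (𝓝 1)) (hB : Tendsto (fun n => P (B n)ᶜ) atTop (𝓝 0))
    (hC : ∀ᶠ n in atTop, A n ∩ B n ⊆ C n) : Tendsto (fun n => P (C n)) atTop (𝓝 1) := by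
  have h1 : Tendsto (fun n => P (A n) - P (B n)ᶜ) atTop (𝓝 1) := by
    simpa using ENNReal.Tendsto.sub hA hB (Or.inl ENNReal.one_ne_top)
  refine tendsto_of_tendsto_of_tendsto_of_le_of_le' h1 tendsto_const_nhds ?_
    (.of_forall fun n => prob_le_one)
  filter_upwards [hC] with n hn
  rw [tsub_le_iff_right]
  refine (measure_mono fun ω hω => ?_).trans (measure_union_le (C n) (B n)ᶜ)
  by_cases hω' : ω ∈ B n
  · exact Or.inl (hn ⟨hω, hω'⟩)
  · exact Or.inr hω'

/-- It suffices to compare the lengths of self-avoiding paths on events of probability tending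
to one. -/
lemma mem_lfppExponentSet_of_forall_path [IsProbabilityMeasure P] {α β ξ ζ : ℝ}
    (hα : α ∈ lfppExponentSet h P ξ) {B : ℕ → Set Ω}
    (hB : Tendsto (fun n => P (B n)ᶜ) atTop (𝓝 0))
    (hlen : ∀ᶠ n : ℕ in atTop, ∀ ω ∈ B n, ∀ z w, ∀ p : (latticeGraph d).Walk z w, p.IsPath →
      (∀ v ∈ p.support, v ∈ cubeFinset d n) →
      lfppLength (1 / (n : ℝ)) ξ (boxField h n · ω) p ≤ 2 * (n : ℝ) ^ (-α) →
      lfppLength (1 / (n : ℝ)) ζ (boxField h n · ω) p ≤ (n : ℝ) ^ (-β)) :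
    β ∈ lfppExponentSet h P ζ := by
  rw [mem_lfppExponentSet_iff] at hα ⊢
  refine tendsto_measure_one_of_inter_subset hα hB ?_
  filter_upwards [hlen, eventually_ne_atTop 0] with n hn hn0 ω ⟨hωA, hωB⟩
  have hpow : ∀ γ : ℝ, (1 / (n : ℝ)) ^ γ = (n : ℝ) ^ (-γ) := fun γ => by
    rw [one_div, Real.inv_rpow (by positivity), Real.rpow_neg (by positivity)]
  have hpos : 0 < (n : ℝ) ^ (-α) := by positivity
  have hωA : lfppCrossing h (1 / (n : ℝ)) ξ ω ≤ ENNReal.ofReal ((1 / (n : ℝ)) ^ α) := hωA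
  change lfppCrossing h (1 / (n : ℝ)) ζ ω ≤ ENNReal.ofReal ((1 / (n : ℝ)) ^ β)
  rw [hpow] at hωA ⊢
  -- The infimum need not be attained; the factor 2 gives a strict inequality, hence an actual path.
  have hlt := hωA.trans_lt (b := ENNReal.ofReal ((n : ℝ) ^ (-α)))
    (c := ENNReal.ofReal (2 * (n : ℝ) ^ (-α)))
    ((ENNReal.ofReal_lt_ofReal_iff (by positivity)).mpr (by linarith))
  obtain ⟨z, hz, w, hw, p, hp, hpl⟩ := lfppDist_lt_iff.mp hlt
  have hp' : ∀ v ∈ p.bypass.support, v ∈ latticeCube d (1 / (n : ℝ)) := fun v hv =>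
    hp v (p.support_bypass_subset_support hv)
  refine (lfppDist_le_of_walk hz hw p.bypass hp').trans (ENNReal.ofReal_le_ofReal ?_)
  refine hn ω hωB z w p.bypass p.bypass_isPath
    (fun v hv => (mem_latticeCube_iff hn0).mp (hp' v hv)) ?_
  exact (lfppLength_bypass_le (by positivity) _ _).trans
    ((ENNReal.ofReal_lt_ofReal_iff (by positivity)).mp hpl).le

/-- Markov's inequality for the sum of the exponential moments over the cube. -/
lemma IsLGF.exists_measure_sum_exp_le (hd : 2 ≤ d) (hh : IsLGF h P) (t : ℝ) :
    ∃ K : ℝ, ∀ n : ℕ, n ≠ 0 → ∀ a : ℝ,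
      P {ω | ∑ z ∈ cubeFinset d n, Real.exp (t * boxField h n z ω) ≤ (n : ℝ) ^ a}ᶜ ≤
        ENNReal.ofReal (K * (n : ℝ) ^ (d + t ^ 2 / 2 - a)) := by
  obtain ⟨K, hK, hle⟩ := hh.exists_lintegral_exp_boxField_le hd t
  refine ⟨2 ^ d * K, fun n hn a => ?_⟩
  have hn' : (0 : ℝ) < n := by positivity
  have hmeas : ∀ z, AEMeasurable (fun ω => ENNReal.ofReal (Real.exp (t * boxField h n z ω))) P :=
    fun z => (((hh.hasGaussianLaw_boxField (by omega) hn z).aemeasurable.const_mul t).exp).ennreal_ofReal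
  have h1 : ∫⁻ ω, ∑ z ∈ cubeFinset d n, ENNReal.ofReal (Real.exp (t * boxField h n z ω)) ∂P ≤
      ENNReal.ofReal (2 ^ d * K * (n : ℝ) ^ (d + t ^ 2 / 2)) := by
    rw [lintegral_finsetSum' _ fun z _ => hmeas z]
    calc _ ≤ ∑ z ∈ cubeFinset d n, ENNReal.ofReal (K * (n : ℝ) ^ (t ^ 2 / 2)) :=
          Finset.sum_le_sum fun z hz => hle n hn z ((mem_latticeCube_iff hn).mpr hz)
      _ ≤ _ := by
          rw [Finset.sum_const, nsmul_eq_mul, ← ENNReal.ofReal_natCast,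
            ← ENNReal.ofReal_mul (by positivity)]
          apply ENNReal.ofReal_le_ofReal
          rw [Real.rpow_add hn']
          calc _ ≤ (2 ^ d * (n : ℝ) ^ (d : ℝ)) * (K * (n : ℝ) ^ (t ^ 2 / 2)) := by
                gcongr
                exact card_cubeFinset_le hn
            _ = _ := by ring
  have hmeas' : AEMeasurable (fun ω => ∑ z ∈ cubeFinset d n,
      ENNReal.ofReal (Real.exp (t * boxField h n z ω))) P :=
    Finset.aemeasurable_fun_sum _ fun z _ => hmeas z
  have hpos : 0 < (n : ℝ) ^ a := by positivity
  have h2 := meas_ge_le_lintegral_div hmeas' (ε := ENNReal.ofReal ((n : ℝ) ^ a))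
    (ENNReal.ofReal_pos.mpr hpos).ne' ENNReal.ofReal_ne_top
  refine (measure_mono fun ω hω => ?_).trans (h2.trans ((ENNReal.div_le_div_right h1 _).trans_eq ?_))
  · have hω : ¬ (∑ z ∈ cubeFinset d n, Real.exp (t * boxField h n z ω) ≤ (n : ℝ) ^ a) := hω
    rw [Set.mem_ofPred_eq]
    rw [← ENNReal.ofReal_sum_of_nonneg fun _ _ => (Real.exp_pos _).le]
    exact ENNReal.ofReal_le_ofReal (not_le.mp hω).le
  · rw [← ENNReal.ofReal_div_of_pos hpos, Real.rpow_sub hn', mul_div_assoc]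

lemma IsLGF.tendsto_measure_exists_abs_boxField_gt (hd : 2 ≤ d) (hh : IsLGF h P) {c : ℝ}
    (hc : √(2 * d) < c) :
    Tendsto (fun n : ℕ => P {ω | ∀ z ∈ cubeFinset d n, |boxField h n z ω| ≤ c * Real.log n}ᶜ)
      atTop (𝓝 0) := by
  have hc0 : 0 < c := (Real.sqrt_nonneg _).trans_lt hc
  have hc2 : 2 * (d : ℝ) < c ^ 2 := (Real.sqrt_lt' hc0).mp hc
  obtain ⟨K₁, h₁⟩ := hh.exists_measure_sum_exp_le hd c
  obtain ⟨K₂, h₂⟩ := hh.exists_measure_sum_exp_le hd (-c)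
  have hδ : 0 < (c ^ 2 - 2 * d) / 2 := by linarith
  have hlim := (tendsto_ofReal_mul_rpow_neg K₁ hδ).add (tendsto_ofReal_mul_rpow_neg K₂ hδ)
  rw [add_zero] at hlim
  refine tendsto_of_tendsto_of_tendsto_of_le_of_le' tendsto_const_nhds hlim
    (.of_forall fun n => zero_le) ?_
  filter_upwards [eventually_ne_atTop 0] with n hn
  have hn' : (0 : ℝ) < n := by positivity
  -- The choice `t = ±c`, `a = c²` gives the exponent `d - c² / 2 < 0`, and a single term `exp (± c
  -- h) ≤ n ^ c²` says `± h ≤ c log n`.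
  have e₁ := h₁ n hn (c ^ 2)
  have e₂ := h₂ n hn (c ^ 2)
  rw [show (d : ℝ) + c ^ 2 / 2 - c ^ 2 = -((c ^ 2 - 2 * d) / 2) by ring] at e₁
  rw [show (d : ℝ) + (-c) ^ 2 / 2 - c ^ 2 = -((c ^ 2 - 2 * d) / 2) by ring] at e₂
  refine (measure_mono ?_).trans ((measure_union_le _ _).trans (add_le_add e₁ e₂))
  rw [← Set.compl_inter]
  refine Set.compl_subset_compl.mpr ?_
  rintro ω ⟨hω₁, hω₂⟩ z hz
  have key : ∀ s : ℝ, ∑ z ∈ cubeFinset d n, Real.exp (s * boxField h n z ω) ≤ (n : ℝ) ^ c ^ 2 →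
      s * boxField h n z ω ≤ c ^ 2 * Real.log n := by
    intro s hs
    have := (Finset.single_le_sum (f := fun z => Real.exp (s * boxField h n z ω))
      (fun _ _ => (Real.exp_pos _).le) hz).trans hs
    rw [Real.rpow_def_of_pos hn', Real.exp_le_exp] at this
    linarith
  have k₁ := key c hω₁
  have k₂ := key (-c) hω₂
  rw [abs_le]
  constructor <;> nlinarith

end events

/-! ### Transfer of exponents between parameters by pathwise comparison. -/

section transfer
variable {d : ℕ} {Ω : Type*} [MeasurableSpace Ω] {P : Measure Ω} [IsProbabilityMeasure P]
  {h : Measure (EuclideanSpace ℝ (Fin d)) → Ω → ℝ}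

lemma IsLGF.sub_abs_mul_mem_lfppExponentSet (hd : 2 ≤ d) (hh : IsLGF h P) {ξ ζ α c δ : ℝ}
    (hα : α ∈ lfppExponentSet h P ξ) (hc : √(2 * d) < c) (hδ : 0 < δ) :
    α - |ζ - ξ| * c - δ ∈ lfppExponentSet h P ζ := by
  refine mem_lfppExponentSet_of_forall_path hα (hh.tendsto_measure_exists_abs_boxField_gt hd hc) ?_
  filter_upwards [eventually_ne_atTop 0, eventually_le_natCast_rpow 2 hδ] with n hn hn2 ω hω z w p
    hp hpc hlen
  have hn' : (0 : ℝ) < n := by positivity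
  have h1 : lfppLength (1 / (n : ℝ)) ζ (boxField h n · ω) p ≤
      (n : ℝ) ^ (|ζ - ξ| * c) * lfppLength (1 / (n : ℝ)) ξ (boxField h n · ω) p := by
    refine lfppLength_le_mul fun v hv => ?_
    have hv' : |boxField h n v ω| ≤ c * Real.log n := hω v (hpc v hv)
    have h2 : (ζ - ξ) * boxField h n v ω ≤ |ζ - ξ| * (c * Real.log n) := by
      refine (le_abs_self _).trans ?_
      rw [abs_mul]
      gcongr
    rw [mul_left_comm, Real.rpow_def_of_pos hn', ← Real.exp_add]
    gcongr
    linarith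
  calc _ ≤ (n : ℝ) ^ (|ζ - ξ| * c) * ((n : ℝ) ^ δ * (n : ℝ) ^ (-α)) := h1.trans (by
        gcongr
        exact hlen.trans (by gcongr))
    _ = _ := by
        rw [← Real.rpow_add hn', ← Real.rpow_add hn']
        ring_nf

lemma one_add_mul_sub_one_mem_lfppExponentSet {q ξ α δ : ℝ} (hq : 1 ≤ q)
    (hα : α ∈ lfppExponentSet h P ξ) (hδ : 0 < δ) :
    1 + q * (α - 1) - δ ∈ lfppExponentSet h P (q * ξ) := by
  refine mem_lfppExponentSet_of_forall_path hα (B := fun _ => Set.univ) (by simp) ?_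
  filter_upwards [eventually_ne_atTop 0, eventually_le_natCast_rpow (2 ^ q) hδ] with n hn hn2 ω _
    z w p hp hpc hlen
  have hn' : (0 : ℝ) < n := by positivity
  have hl0 : 0 ≤ lfppLength (1 / (n : ℝ)) ξ (boxField h n · ω) p :=
    List.sum_nonneg fun x hx => by
      obtain ⟨b, -, rfl⟩ := List.mem_map.mp hx
      positivity
  calc _ ≤ 1 / (n : ℝ) * (lfppLength (1 / (n : ℝ)) ξ (boxField h n · ω) p / (1 / (n : ℝ))) ^ q :=
        lfppLength_le_rpow (by positivity) hq _ p
    _ ≤ 1 / (n : ℝ) * ((2 * (n : ℝ) ^ (-α)) / (1 / (n : ℝ))) ^ q := by gcongr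
    _ = 2 ^ q * (n : ℝ) ^ (-(1 + q * (α - 1))) := by
        have h1 : 2 * (n : ℝ) ^ (-α) / (1 / (n : ℝ)) = 2 * (n : ℝ) ^ (1 - α) := by
          rw [div_div_eq_mul_div, div_one, mul_assoc, ← Real.rpow_add_one hn'.ne']
          ring_nf
        rw [h1, Real.mul_rpow zero_le_two (by positivity), ← Real.rpow_mul hn'.le, one_div,
          ← Real.rpow_neg_one, mul_left_comm, ← Real.rpow_add hn']
        ring_nf
    _ ≤ (n : ℝ) ^ δ * (n : ℝ) ^ (-(1 + q * (α - 1))) := by gcongr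
    _ = _ := by
        rw [← Real.rpow_add hn']
        ring_nf

/-- The two entries of the minimum come from the vertices above and below the threshold `-c log n`.
Below it, `exp (ζ h) ≤ n ^ (-(c + ζ) c) exp (-c h)`, and the cube sum of `exp (-c h)` has order at
most `n ^ (d + c² / 2)`; with the factor `ε` the total exponent is `-(1 - d + c² / 2 + c ζ)`. -/
lemma IsLGF.min_mem_lfppExponentSet (hd : 2 ≤ d) (hh : IsLGF h P) {ξ ζ α c δ : ℝ}
    (hα : α ∈ lfppExponentSet h P ξ) (hζ : ζ ≤ ξ) (hc : 0 ≤ c + ζ) (hδ : 0 < δ) :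
    min (α - (ξ - ζ) * c) (1 - d + ((c + ζ) ^ 2 - ζ ^ 2) / 2) - δ ∈ lfppExponentSet h P ζ := by
  obtain ⟨K, hK⟩ := hh.exists_measure_sum_exp_le hd (-c)
  set β := min (α - (ξ - ζ) * c) (1 - d + ((c + ζ) ^ 2 - ζ ^ 2) / 2) with hβ
  refine mem_lfppExponentSet_of_forall_path hα (B := fun n => {ω | ∑ z ∈ cubeFinset d n,
    Real.exp (-c * boxField h n z ω) ≤ (n : ℝ) ^ (d + c ^ 2 / 2 + δ / 2)}) ?_ ?_
  · refine tendsto_of_tendsto_of_tendsto_of_le_of_le' tendsto_const_nhds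
      (tendsto_ofReal_mul_rpow_neg K (half_pos hδ)) (.of_forall fun n => zero_le) ?_
    filter_upwards [eventually_ne_atTop 0] with n hn
    refine (hK n hn _).trans_eq ?_
    rw [neg_sq, sub_add_cancel_left]
  -- The constant is `3 = 1 + 2`: one from the low vertices, two from the near-optimal length.
  filter_upwards [eventually_ne_atTop 0, eventually_le_natCast_rpow 3 (half_pos hδ)] with n hn hn3
    ω hω z w p hp hpc hlen
  have hn' : (0 : ℝ) < n := by positivity
  have hn1 : (1 : ℝ) ≤ n := by exact_mod_cast Nat.one_le_iff_ne_zero.mpr hn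
  have hω : ∑ z ∈ cubeFinset d n, Real.exp (-c * boxField h n z ω) ≤
    (n : ℝ) ^ (d + c ^ 2 / 2 + δ / 2) := hω
  have hterm : ∀ v, 1 / (n : ℝ) * Real.exp (ζ * boxField h n v ω) ≤
      (n : ℝ) ^ (-1 - (c + ζ) * c) * Real.exp (-c * boxField h n v ω) +
        (n : ℝ) ^ ((ξ - ζ) * c) * (1 / (n : ℝ) * Real.exp (ξ * boxField h n v ω)) := by
    intro v
    have hinv : 1 / (n : ℝ) = Real.exp (Real.log n * -1) := by
      rw [← Real.rpow_def_of_pos hn', Real.rpow_neg_one, one_div]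
    rw [hinv, Real.rpow_def_of_pos hn', Real.rpow_def_of_pos hn']
    simp only [← Real.exp_add]
    rcases le_total (boxField h n v ω) (-c * Real.log n) with hv | hv
    · refine le_add_of_le_of_nonneg (Real.exp_le_exp.mpr ?_) (Real.exp_pos _).le
      nlinarith
    · refine le_add_of_nonneg_of_le (Real.exp_pos _).le (Real.exp_le_exp.mpr ?_)
      nlinarith
  have hsub : p.support.toFinset ⊆ cubeFinset d n := fun v hv => hpc v (List.mem_toFinset.mp hv)
  calc lfppLength (1 / (n : ℝ)) ζ (boxField h n · ω) p
      ≤ (n : ℝ) ^ (-1 - (c + ζ) * c) *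
          ∑ v ∈ cubeFinset d n, Real.exp (-c * boxField h n v ω) +
        (n : ℝ) ^ ((ξ - ζ) * c) * lfppLength (1 / (n : ℝ)) ξ (boxField h n · ω) p := by
        rw [lfppLength_eq_sum _ hp, lfppLength_eq_sum _ hp]
        refine (Finset.sum_le_sum fun v _ => hterm v).trans ?_
        rw [Finset.sum_add_distrib, ← Finset.mul_sum, ← Finset.mul_sum]
        gcongr
    _ ≤ (n : ℝ) ^ (-1 - (c + ζ) * c) * (n : ℝ) ^ (d + c ^ 2 / 2 + δ / 2) +
        (n : ℝ) ^ ((ξ - ζ) * c) * (2 * (n : ℝ) ^ (-α)) := by gcongr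
    _ ≤ (n : ℝ) ^ (-β + δ / 2) + 2 * (n : ℝ) ^ (-β + δ / 2) := by
        rw [mul_left_comm, ← Real.rpow_add hn', ← Real.rpow_add hn']
        have h1 := min_le_left (α - (ξ - ζ) * c) (1 - d + ((c + ζ) ^ 2 - ζ ^ 2) / 2)
        have h2 := min_le_right (α - (ξ - ζ) * c) (1 - d + ((c + ζ) ^ 2 - ζ ^ 2) / 2)
        rw [← hβ] at h1 h2
        exact add_le_add (Real.rpow_le_rpow_of_exponent_le hn1 (by linarith))
          (mul_le_mul_of_nonneg_left (Real.rpow_le_rpow_of_exponent_le hn1 (by linarith))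
            zero_le_two)
    _ = 3 * (n : ℝ) ^ (-β + δ / 2) := by ring
    _ ≤ (n : ℝ) ^ (δ / 2) * (n : ℝ) ^ (-β + δ / 2) := by gcongr
    _ = _ := by
        rw [← Real.rpow_add hn']
        ring_nf

end transfer

/-! ### The parameter zero. -/

section base
variable {d : ℕ}

lemma latticeGraph_adj_single (i₀ : Fin d) (z : Fin d → ℤ) :
    (latticeGraph d).Adj (z + Pi.single i₀ 1) z := by
  change ∑ i, |(z + Pi.single i₀ 1 : Fin d → ℤ) i - z i| = 1
  simp [Pi.single_apply, apply_ite abs]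

/-- The walk runs towards the origin so that the induction step prepends a vertex; it is reversed
when used. -/
lemma exists_walk_single (i₀ : Fin d) (n : ℕ) :
    ∃ p : (latticeGraph d).Walk (Pi.single i₀ (n : ℤ)) 0, p.length = n ∧
      ∀ v ∈ p.support, v ∈ cubeFinset d n := by
  induction n with
  | zero =>
    have h0 : (Pi.single i₀ ((0 : ℕ) : ℤ) : Fin d → ℤ) = 0 := Pi.single_zero i₀
    rw [h0]
    refine ⟨.nil, rfl, fun v hv => ?_⟩
    rw [SimpleGraph.Walk.support_nil, List.mem_singleton] at hv
    subst hv
    exact Fintype.mem_piFinset.mpr fun i => by simp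
  | succ n ih =>
    obtain ⟨p, hp, hps⟩ := ih
    have hadj : (latticeGraph d).Adj (Pi.single i₀ ((n + 1 : ℕ) : ℤ)) (Pi.single i₀ (n : ℤ)) := by
      have := latticeGraph_adj_single i₀ (Pi.single i₀ (n : ℤ))
      rwa [← Pi.single_add] at this
    refine ⟨.cons hadj p, by simp [hp], fun v hv => ?_⟩
    rw [SimpleGraph.Walk.support_cons, List.mem_cons] at hv
    simp only [cubeFinset, Fintype.mem_piFinset, Finset.mem_Icc] at hps ⊢
    rcases hv with rfl | hv
    · intro i
      rcases eq_or_ne i i₀ with rfl | hi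
      · simp
        omega
      · simp [hi]
        omega
    · intro i
      have := hps v hv i
      push_cast
      omega

variable {Ω : Type*} [MeasurableSpace Ω] {P : Measure Ω} [IsProbabilityMeasure P]
  {h : Measure (EuclideanSpace ℝ (Fin d)) → Ω → ℝ}

lemma neg_one_mem_lfppExponentSet_zero (hd : 0 < d) : -1 ∈ lfppExponentSet h P 0 := by
  rw [mem_lfppExponentSet_iff]
  refine tendsto_const_nhds.congr' ?_
  filter_upwards [eventually_ge_atTop 2] with n hn
  have hn0 : n ≠ 0 := by omega
  have hn' : (2 : ℝ) ≤ n := by exact_mod_cast hn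
  obtain ⟨p, hp, hps⟩ := exists_walk_single (d := d) ⟨0, hd⟩ n
  rw [eq_comm, ← measure_univ (μ := P)]
  congr 1
  refine Set.eq_univ_of_forall fun ω => ?_
  have hz : (0 : Fin d → ℤ) ∈ leftBoundary d (1 / (n : ℝ)) :=
    ⟨(mem_latticeCube_iff hn0).mpr (hps _ p.end_mem_support), fun i _ => by simp [latticePoint]⟩
  have hw : (Pi.single ⟨0, hd⟩ (n : ℤ) : Fin d → ℤ) ∈ rightBoundary d (1 / (n : ℝ)) := by
    refine ⟨(mem_latticeCube_iff hn0).mpr (hps _ p.start_mem_support), fun i hi => ?_⟩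
    have : i = ⟨0, hd⟩ := Fin.ext hi
    subst this
    simp [latticePoint, hn0]
  refine (lfppDist_le_of_walk hz hw p.reverse fun v hv => ?_).trans (ENNReal.ofReal_le_ofReal ?_)
  · rw [SimpleGraph.Walk.support_reverse, List.mem_reverse] at hv
    exact (mem_latticeCube_iff hn0).mpr (hps v hv)
  · simp only [lfppLength, zero_mul, Real.exp_zero, mul_one, List.map_const', List.sum_replicate,
      SimpleGraph.Walk.length_support, SimpleGraph.Walk.length_reverse, hp, nsmul_eq_mul]
    rw [Real.rpow_neg_one, one_div, inv_inv, mul_inv_le_iff₀ (by linarith)]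
    push_cast
    nlinarith

lemma le_one_of_mem_lfppExponentSet_zero {α : ℝ} (hα : α ∈ lfppExponentSet h P 0) : α ≤ 1 := by
  by_contra! hα1
  rw [mem_lfppExponentSet_iff] at hα
  refine zero_ne_one (tendsto_nhds_unique (tendsto_const_nhds.congr' ?_) hα)
  filter_upwards [eventually_ge_atTop 2] with n hn
  have hn' : (2 : ℝ) ≤ n := by exact_mod_cast hn
  rw [eq_comm, ← measure_empty (μ := P)]
  congr 1
  refine Set.eq_empty_of_forall_notMem fun ω hω => ?_
  -- Every walk has at least one vertex and hence length at least `1 / n`, so for `α > 1` the event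
  -- is empty.
  have hlt : ENNReal.ofReal ((1 / (n : ℝ)) ^ α) < ENNReal.ofReal (1 / (n : ℝ)) := by
    rw [ENNReal.ofReal_lt_ofReal_iff (by positivity)]
    conv_rhs => rw [← Real.rpow_one (1 / (n : ℝ))]
    exact Real.rpow_lt_rpow_of_exponent_gt (by positivity)
      (by rw [div_lt_one (by linarith)]; linarith) hα1
  obtain ⟨z, hz, w, hw, p, hp, hpl⟩ := lfppDist_lt_iff.mp (lt_of_le_of_lt hω hlt)
  refine hpl.not_ge (ENNReal.ofReal_le_ofReal ?_)
  simp only [lfppLength, zero_mul, Real.exp_zero, mul_one, List.map_const', List.sum_replicate,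
      SimpleGraph.Walk.length_support, nsmul_eq_mul]
  refine le_mul_of_one_le_left (by positivity) ?_
  push_cast
  linarith [Nat.cast_nonneg (α := ℝ) p.length]

end base

/-! ### Gaussian rotation and averaging over an independent copy. -/

section smoothing
variable {d : ℕ}

lemma lfppDist_congr {ε ξ : ℝ} {φ ψ : (Fin d → ℤ) → ℝ} {A B S : Set (Fin d → ℤ)}
    (hφ : ∀ v ∈ S, φ v = ψ v) : lfppDist ε ξ φ A B S = lfppDist ε ξ ψ A B S := by
  unfold lfppDist
  refine iInf_congr fun z => iInf_congr fun _ => iInf_congr fun w => iInf_congr fun _ =>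
    iInf_congr fun p => iInf_congr fun hp => ?_
  unfold lfppLength
  rw [List.map_congr_left fun v hv => by rw [hφ v (hp v hv)]]

/-- The extension by zero of a function on a finite set of vertices. -/
noncomputable def extendZero {V : Finset (Fin d → ℤ)} (x : V → ℝ) (v : Fin d → ℤ) : ℝ :=
  open Classical in if hv : v ∈ V then x ⟨v, hv⟩ else 0

lemma extendZero_apply {V : Finset (Fin d → ℤ)} (x : V → ℝ) {v : Fin d → ℤ} (hv : v ∈ V) :
    extendZero x v = x ⟨v, hv⟩ := by
  simp [extendZero, hv]

lemma continuous_extendZero {V : Finset (Fin d → ℤ)} (v : Fin d → ℤ) :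
    Continuous fun x : V → ℝ => extendZero x v := by
  by_cases hv : v ∈ V
  · simp only [extendZero_apply _ hv]
    fun_prop
  · simp only [extendZero, hv, dite_false]
    fun_prop

/-- An infimum of continuous functions of the weights is upper semicontinuous. -/
lemma measurable_lfppDist_extendZero (ε ξ : ℝ) (V : Finset (Fin d → ℤ))
    (A B S : Set (Fin d → ℤ)) :
    Measurable fun x : V → ℝ => lfppDist ε ξ (extendZero x) A B S := by
  refine UpperSemicontinuous.measurable ?_
  unfold lfppDist
  refine upperSemicontinuous_iInf fun z => upperSemicontinuous_iInf fun _ =>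
    upperSemicontinuous_iInf fun w => upperSemicontinuous_iInf fun _ =>
    upperSemicontinuous_iInf fun p => upperSemicontinuous_iInf fun _ =>
    Continuous.upperSemicontinuous ?_
  refine ENNReal.continuous_ofReal.comp (continuous_list_sum _ fun v _ => ?_)
  have := continuous_extendZero (V := V) v
  fun_prop

/-- Adding an independent centered Gaussian vector to the weights increases the distance by at most
a multiple of the exponential moment, up to an event controlled by Markov's inequality. -/
lemma measure_lfppDist_le_add {V : Finset (Fin d → ℤ)} (ν : Measure (V → ℝ)) [IsGaussian ν]
    (hν : ν[id] = 0) {A B S : Set (Fin d → ℤ)} (hS : ∀ v ∈ S, v ∈ V) {ε ζ θ a b M : ℝ}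
    (hε : 0 ≤ ε) (ha : 0 < a) (hb : 0 < b) (hM : 0 ≤ M)
    (hexp : ∀ v : V, ∫⁻ x, ENNReal.ofReal (Real.exp (ζ * Real.sin θ * x v)) ∂ν ≤
      ENNReal.ofReal M) :
    ν {x | lfppDist ε (ζ * Real.cos θ) (extendZero x) A B S ≤ ENNReal.ofReal a} ≤
      ν {x | lfppDist ε ζ (extendZero x) A B S ≤ ENNReal.ofReal b} +
        ENNReal.ofReal (M * (2 * a) / b) := by
  set G := {x : V → ℝ | lfppDist ε (ζ * Real.cos θ) (extendZero x) A B S ≤ ENNReal.ofReal a}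
    with hG
  set T := {x : V → ℝ | lfppDist ε ζ (extendZero x) A B S ≤ ENNReal.ofReal b} with hT
  have hTm : MeasurableSet T :=
    measurableSet_le (measurable_lfppDist_extendZero _ _ _ _ _ _) measurable_const
  have hGm : MeasurableSet G :=
    measurableSet_le (measurable_lfppDist_extendZero _ _ _ _ _ _) measurable_const
  -- A rotation preserves `ν ⊗ ν`, and the first coordinate of the rotated pair is `cos θ • p.1 +
  -- sin θ • p.2`.
  have hrot : ν T = (ν.prod ν) {p | Real.cos θ • p.1 + Real.sin θ • p.2 ∈ T} := by
    have h1 : (ν.prod ν) (Prod.fst ⁻¹' T) = ν T := by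
      rw [← Set.prod_univ, Measure.prod_prod, measure_univ, mul_one]
    rw [← h1, ← IsGaussian.map_rotation_eq_self hν θ,
      Measure.map_apply (by fun_prop) (measurable_fst hTm),
      IsGaussian.map_rotation_eq_self hν θ]
    rfl
  have hm2 : MeasurableSet {p : (V → ℝ) × (V → ℝ) | Real.cos θ • p.1 + Real.sin θ • p.2 ∈ T} :=
    measurableSet_preimage (by fun_prop) hTm
  -- The bound is proved for each fixed `x`, with a path that depends on `x` alone. It no longer
  -- mentions the path, so integrating it over `G` needs no measurable selection.
  have hfib : ∀ x ∈ G, 1 ≤ ν (Prod.mk x ⁻¹' {p | Real.cos θ • p.1 + Real.sin θ • p.2 ∈ T}) +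
      ENNReal.ofReal (M * (2 * a) / b) := by
    intro x hx
    have hlt : lfppDist ε (ζ * Real.cos θ) (extendZero x) A B S < ENNReal.ofReal (2 * a) :=
      lt_of_le_of_lt hx ((ENNReal.ofReal_lt_ofReal_iff (by positivity)).mpr (by linarith))
    obtain ⟨z, hz, w, hw, p, hp, hpl⟩ := lfppDist_lt_iff.mp hlt
    have hp' : ∀ v ∈ p.bypass.support, v ∈ S := fun v hv =>
      hp v (p.support_bypass_subset_support hv)
    have hpl' : lfppLength ε (ζ * Real.cos θ) (extendZero x) p.bypass ≤ 2 * a :=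
      (lfppLength_bypass_le hε _ _).trans
        ((ENNReal.ofReal_lt_ofReal_iff (by positivity)).mp hpl).le
    set q := p.bypass
    have hq : q.IsPath := p.bypass_isPath
    set len : (V → ℝ) → ℝ≥0∞ := fun y => ∑ v ∈ q.support.toFinset,
      ENNReal.ofReal (ε * Real.exp (ζ * Real.cos θ * extendZero x v)) *
        ENNReal.ofReal (Real.exp (ζ * Real.sin θ * extendZero y v)) with hlen
    have hterm : ∀ v, Measurable fun y : V → ℝ =>
        ENNReal.ofReal (ε * Real.exp (ζ * Real.cos θ * extendZero x v)) *
        ENNReal.ofReal (Real.exp (ζ * Real.sin θ * extendZero y v)) := fun v => by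
      have := (continuous_extendZero (V := V) v).measurable
      fun_prop
    have hlenm : Measurable len := Finset.measurable_fun_sum _ fun v _ => hterm v
    have hlen_eq : ∀ y, ENNReal.ofReal
        (lfppLength ε ζ (extendZero (Real.cos θ • x + Real.sin θ • y)) q) = len y := by
      intro y
      rw [lfppLength_eq_sum _ hq, ENNReal.ofReal_sum_of_nonneg fun v _ => by positivity]
      refine Finset.sum_congr rfl fun v hv => ?_
      have hv' : v ∈ V := hS v (hp' v (List.mem_toFinset.mp hv))
      rw [← ENNReal.ofReal_mul (by positivity), mul_assoc, ← Real.exp_add,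
        extendZero_apply _ hv', extendZero_apply _ hv', extendZero_apply _ hv']
      simp only [Pi.add_apply, Pi.smul_apply, smul_eq_mul]
      ring_nf
    have hint : ∫⁻ y, len y ∂ν ≤ ENNReal.ofReal (M * (2 * a)) := by
      rw [hlen, lintegral_finsetSum _ fun v _ => hterm v]
      calc _ ≤ ∑ v ∈ q.support.toFinset,
            ENNReal.ofReal (ε * Real.exp (ζ * Real.cos θ * extendZero x v)) *
              ENNReal.ofReal M := by
            refine Finset.sum_le_sum fun v hv => ?_
            have hv' : v ∈ V := hS v (hp' v (List.mem_toFinset.mp hv))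
            have := (continuous_extendZero (V := V) v).measurable
            rw [lintegral_const_mul _ (by fun_prop)]
            simp only [extendZero_apply _ hv']
            gcongr
            exact hexp ⟨v, hv'⟩
        _ = ENNReal.ofReal (M * lfppLength ε (ζ * Real.cos θ) (extendZero x) q) := by
            rw [← Finset.sum_mul, ← ENNReal.ofReal_sum_of_nonneg fun v _ => by positivity,
              ← lfppLength_eq_sum _ hq, mul_comm, ENNReal.ofReal_mul hM]
        _ ≤ _ := ENNReal.ofReal_le_ofReal (by gcongr)
    have hmarkov := meas_ge_le_lintegral_div hlenm.aemeasurable (μ := ν)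
      (ε := ENNReal.ofReal b) (ENNReal.ofReal_pos.mpr hb).ne' ENNReal.ofReal_ne_top
    rw [← measure_univ (μ := ν)]
    refine (measure_mono (t := (Prod.mk x ⁻¹' {p | Real.cos θ • p.1 + Real.sin θ • p.2 ∈ T}) ∪
      {y | ENNReal.ofReal b ≤ len y}) fun y _ => ?_).trans ((measure_union_le _ _).trans ?_)
    · rcases le_total (len y) (ENNReal.ofReal b) with hy | hy
      · refine Or.inl ?_
        change lfppDist ε ζ (extendZero (Real.cos θ • x + Real.sin θ • y)) A B S ≤
          ENNReal.ofReal b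
        exact (lfppDist_le_of_walk hz hw q hp').trans ((hlen_eq y).trans_le hy)
      · exact Or.inr hy
    · gcongr
      refine hmarkov.trans ?_
      rw [ENNReal.ofReal_div_of_pos hb]
      gcongr
  calc ν G = ∫⁻ x in G, 1 ∂ν := by simp
    _ ≤ ∫⁻ x in G, (ν (Prod.mk x ⁻¹' {p | Real.cos θ • p.1 + Real.sin θ • p.2 ∈ T}) +
          ENNReal.ofReal (M * (2 * a) / b)) ∂ν := setLIntegral_mono' hGm hfib
    _ ≤ ∫⁻ x, (ν (Prod.mk x ⁻¹' {p | Real.cos θ • p.1 + Real.sin θ • p.2 ∈ T}) +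
          ENNReal.ofReal (M * (2 * a) / b)) ∂ν := setLIntegral_le_lintegral _ _
    _ = ν T + ENNReal.ofReal (M * (2 * a) / b) := by
        rw [lintegral_add_right _ measurable_const, lintegral_const, measure_univ, mul_one, hrot,
          Measure.prod_apply hm2]

variable {Ω : Type*} [MeasurableSpace Ω] {P : Measure Ω}
  {h : Measure (EuclideanSpace ℝ (Fin d)) → Ω → ℝ}

lemma IsLGF.hasGaussianLaw_restrict_boxField (hd : d ≠ 0) (hh : IsLGF h P) {n : ℕ} (hn : n ≠ 0)
    (V : Finset (Fin d → ℤ)) : HasGaussianLaw (fun ω => V.restrict (boxField h n · ω)) P :=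
  (hh.gaussian.comp_right fun z => ⟨boxMeasure (1 / (n : ℝ)) (latticePoint (1 / (n : ℝ)) z),
    finiteLogEnergy_boxMeasure hd (by positivity) _⟩).hasGaussianLaw V

lemma IsLGF.integral_id_map_restrict_boxField (hd : d ≠ 0) (hh : IsLGF h P) {n : ℕ} (hn : n ≠ 0)
    (V : Finset (Fin d → ℤ)) :
    ∫ x, id x ∂(P.map fun ω => V.restrict (boxField h n · ω)) = 0 := by
  have hX := hh.hasGaussianLaw_restrict_boxField hd hn V
  rw [integral_map hX.aemeasurable (by fun_prop)]
  funext v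
  simp only [id_eq]
  rw [eval_integral (f := fun ω => V.restrict (boxField h n · ω))
    fun v => (hh.hasGaussianLaw_boxField hd hn v).integrable]
  exact hh.centered _ (finiteLogEnergy_boxMeasure hd (by positivity) _)

lemma IsLGF.measure_lfppCrossing_le_eq (hd : d ≠ 0) (hh : IsLGF h P) {n : ℕ} (hn : n ≠ 0) (ξ : ℝ)
    (a : ℝ≥0∞) :
    P {ω | lfppCrossing h (1 / (n : ℝ)) ξ ω ≤ a} =
      (P.map fun ω => (cubeFinset d n).restrict (boxField h n · ω))
        {x | lfppDist (1 / (n : ℝ)) ξ (extendZero x) (leftBoundary d (1 / (n : ℝ)))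
          (rightBoundary d (1 / (n : ℝ))) (latticeCube d (1 / (n : ℝ))) ≤ a} := by
  rw [Measure.map_apply_of_aemeasurable (hh.hasGaussianLaw_restrict_boxField hd hn _).aemeasurable
    (measurableSet_le (measurable_lfppDist_extendZero _ _ _ _ _ _) measurable_const)]
  congr 1
  ext ω
  have : lfppCrossing h (1 / (n : ℝ)) ξ ω = lfppDist (1 / (n : ℝ)) ξ
      (extendZero ((cubeFinset d n).restrict (boxField h n · ω))) (leftBoundary d (1 / (n : ℝ)))
      (rightBoundary d (1 / (n : ℝ))) (latticeCube d (1 / (n : ℝ))) := by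
    refine lfppDist_congr fun v hv => ?_
    rw [extendZero_apply _ ((mem_latticeCube_iff hn).mp hv)]
    rfl
  simp only [Set.mem_ofPred_eq, Set.mem_preimage, this]

lemma IsLGF.sub_sin_sq_mem_lfppExponentSet [IsProbabilityMeasure P] (hd : 2 ≤ d) (hh : IsLGF h P)
    {ζ θ α δ : ℝ} (hα : α ∈ lfppExponentSet h P (ζ * Real.cos θ)) (hδ : 0 < δ) :
    α - (ζ * Real.sin θ) ^ 2 / 2 - δ ∈ lfppExponentSet h P ζ := by
  obtain ⟨K, hK0, hK⟩ := hh.exists_lintegral_exp_boxField_le hd (ζ * Real.sin θ)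
  have hd0 : d ≠ 0 := by omega
  set β := α - (ζ * Real.sin θ) ^ 2 / 2 - δ with hβ
  rw [mem_lfppExponentSet_iff] at hα ⊢
  have hlim := ENNReal.Tendsto.sub hα (tendsto_ofReal_mul_rpow_neg (2 * K) hδ)
    (Or.inl ENNReal.one_ne_top)
  rw [tsub_zero] at hlim
  refine tendsto_of_tendsto_of_tendsto_of_le_of_le' hlim tendsto_const_nhds ?_
    (.of_forall fun n => prob_le_one)
  filter_upwards [eventually_ne_atTop 0] with n hn
  have hn' : (0 : ℝ) < n := by positivity
  rw [tsub_le_iff_right, hh.measure_lfppCrossing_le_eq hd0 hn,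
    hh.measure_lfppCrossing_le_eq hd0 hn]
  have hX := hh.hasGaussianLaw_restrict_boxField hd0 hn (cubeFinset d n)
  have := hX.isGaussian_map
  refine (measure_lfppDist_le_add (M := K * (n : ℝ) ^ ((ζ * Real.sin θ) ^ 2 / 2)) (ζ := ζ) (θ := θ)
    (b := (1 / (n : ℝ)) ^ β) _ (hh.integral_id_map_restrict_boxField hd0 hn _)
    (fun v hv => (mem_latticeCube_iff hn).mp hv) (by positivity) (by positivity) (by positivity)
    (by positivity) fun v => ?_).trans_eq ?_
  · rw [lintegral_map' (Measurable.aemeasurable (by fun_prop)) hX.aemeasurable]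
    exact hK n hn v ((mem_latticeCube_iff hn).mpr v.2)
  · congr 2
    rw [one_div, Real.inv_rpow hn'.le, Real.inv_rpow hn'.le, ← Real.rpow_neg hn'.le,
      ← Real.rpow_neg hn'.le, div_eq_mul_inv, ← Real.rpow_neg hn'.le]
    have : (n : ℝ) ^ (-δ) = (n : ℝ) ^ ((ζ * Real.sin θ) ^ 2 / 2) * (n : ℝ) ^ (-α) *
        (n : ℝ) ^ (- -β) := by
      rw [← Real.rpow_add hn', ← Real.rpow_add hn']
      congr 1
      rw [hβ]
      ring
    rw [this]
    ring

end smoothing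

/-! ### Inequalities between the exponents. -/

section exponent
variable {d : ℕ} {Ω : Type*} [MeasurableSpace Ω] {P : Measure Ω} [IsProbabilityMeasure P]
  {h : Measure (EuclideanSpace ℝ (Fin d)) → Ω → ℝ}

lemma IsLGF.isLUB_lfppExponent (hd : 2 ≤ d) (hh : IsLGF h P) (ξ : ℝ) :
    IsLUB (lfppExponentSet h P ξ) (lfppExponent h P ξ) := by
  have hc : √(2 * d) < √(2 * d) + 1 := lt_add_one _
  refine isLUB_csSup ⟨_, hh.sub_abs_mul_mem_lfppExponentSet hd
    (neg_one_mem_lfppExponentSet_zero (by omega)) hc one_pos⟩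
    ⟨1 + |0 - ξ| * (√(2 * d) + 1) + 1, fun α hα => ?_⟩
  have := le_one_of_mem_lfppExponentSet_zero
    (hh.sub_abs_mul_mem_lfppExponentSet hd hα hc one_pos (ζ := 0))
  linarith

/-- A continuous map between the exponent sets, up to an arbitrarily small loss, gives an
inequality between the exponents. -/
lemma IsLGF.le_lfppExponent_of_forall_mem (hd : 2 ≤ d) (hh : IsLGF h P) {ξ ζ : ℝ} {g : ℝ → ℝ}
    (hg : Continuous g)
    (H : ∀ α ∈ lfppExponentSet h P ξ, ∀ δ > 0, g α - δ ∈ lfppExponentSet h P ζ) :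
    g (lfppExponent h P ξ) ≤ lfppExponent h P ζ := by
  have h1 : ∀ α ∈ lfppExponentSet h P ξ, g α ≤ lfppExponent h P ζ := fun α hα =>
    le_of_forall_sub_le fun δ hδ => (hh.isLUB_lfppExponent hd ζ).1 (H α hα δ hδ)
  have hlub := hh.isLUB_lfppExponent hd ξ
  have hne : (lfppExponentSet h P ξ).Nonempty := hlub.nonempty
  exact closure_minimal (t := {α | g α ≤ lfppExponent h P ζ}) h1
    (isClosed_le hg continuous_const) (hlub.mem_closure hne)

lemma IsLGF.lfppExponent_sub_le (hd : 2 ≤ d) (hh : IsLGF h P) (ξ ζ : ℝ) :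
    lfppExponent h P ξ - lfppExponent h P ζ ≤ √(2 * d) * |ξ - ζ| := by
  have key : ∀ c, √(2 * d) < c → lfppExponent h P ξ - |ζ - ξ| * c ≤ lfppExponent h P ζ :=
    fun c hc => hh.le_lfppExponent_of_forall_mem hd (g := fun α => α - |ζ - ξ| * c) (by fun_prop)
      fun α hα δ hδ => hh.sub_abs_mul_mem_lfppExponentSet hd hα hc hδ
  have hlim : Tendsto (fun c => lfppExponent h P ξ - |ζ - ξ| * c) (𝓝[>] √(2 * d))
      (𝓝 (lfppExponent h P ξ - |ζ - ξ| * √(2 * d))) :=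
    (Continuous.tendsto (by fun_prop) _).mono_left nhdsWithin_le_nhds
  have := le_of_tendsto hlim (eventually_nhdsWithin_of_forall key)
  rw [abs_sub_comm ξ ζ]
  linarith

lemma IsLGF.lipschitzWith_lfppExponent (hd : 2 ≤ d) (hh : IsLGF h P) :
    LipschitzWith (NNReal.sqrt (2 * d)) (lfppExponent h P) := by
  refine LipschitzWith.of_le_add_mul _ fun ξ ζ => ?_
  have := hh.lfppExponent_sub_le hd ξ ζ
  rw [Real.dist_eq, Real.coe_sqrt]
  push_cast
  linarith

lemma IsLGF.sub_sq_le_lfppExponent (hd : 2 ≤ d) (hh : IsLGF h P) {ξ ζ : ℝ} (hξ : 0 ≤ ξ)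
    (hζ : ξ < ζ) :
    lfppExponent h P ξ - (ζ ^ 2 - ξ ^ 2) / 2 ≤ lfppExponent h P ζ := by
  have hζ0 : 0 < ζ := hξ.trans_lt hζ
  have hcos : ζ * Real.cos (Real.arccos (ξ / ζ)) = ξ := by
    rw [Real.cos_arccos (by linarith [div_nonneg hξ hζ0.le]) ((div_le_one hζ0).mpr hζ.le)]
    field_simp
  have hsin : (ζ * Real.sin (Real.arccos (ξ / ζ))) ^ 2 = ζ ^ 2 - ξ ^ 2 := by
    rw [mul_pow, Real.sin_sq, mul_sub, mul_one, ← mul_pow, hcos]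
  refine hh.le_lfppExponent_of_forall_mem hd (g := fun α => α - (ζ ^ 2 - ξ ^ 2) / 2)
    (by fun_prop) fun α hα δ hδ => ?_
  rw [← hcos] at hα
  have := hh.sub_sin_sq_mem_lfppExponentSet hd hα hδ
  rwa [hsin] at this

lemma IsLGF.one_add_div_mul_le_lfppExponent (hd : 2 ≤ d) (hh : IsLGF h P) {ξ ζ : ℝ} (hξ : 0 < ξ)
    (hζ : ξ < ζ) :
    1 + ζ / ξ * (lfppExponent h P ξ - 1) ≤ lfppExponent h P ζ := by
  refine hh.le_lfppExponent_of_forall_mem hd (g := fun α => 1 + ζ / ξ * (α - 1))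
    (by fun_prop) fun α hα δ hδ => ?_
  have := one_add_mul_sub_one_mem_lfppExponentSet ((one_le_div hξ).mpr hζ.le) hα hδ
  rwa [div_mul_cancel₀ _ hξ.ne'] at this

lemma IsLGF.lfppExponent_le_add_mul (hd : 2 ≤ d) (hh : IsLGF h P) {ξ ζ : ℝ} (hζ : ζ < ξ) :
    lfppExponent h P ξ ≤ lfppExponent h P ζ +
      (ξ - ζ) * (√(2 * ((d : ℝ) - 1) + 2 * lfppExponent h P ζ + ζ ^ 2) - ζ) := by
  set b := √(2 * ((d : ℝ) - 1) + 2 * lfppExponent h P ζ + ζ ^ 2) with hb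
  have key : ∀ s, b < s → lfppExponent h P ξ - (ξ - ζ) * (s - ζ) ≤ lfppExponent h P ζ := by
    intro s hs
    have hb0 : 0 ≤ b := Real.sqrt_nonneg _
    have hs2 := (Real.sqrt_lt' (hb0.trans_lt hs)).mp hs
    have h1 := hh.le_lfppExponent_of_forall_mem hd
      (g := fun α => min (α - (ξ - ζ) * (s - ζ)) (1 - d + ((s - ζ + ζ) ^ 2 - ζ ^ 2) / 2))
      (by fun_prop) fun α hα δ hδ =>
        hh.min_mem_lfppExponentSet hd hα hζ.le (by linarith) hδ
    rcases min_le_iff.mp h1 with h2 | h2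
    · exact h2
    · rw [sub_add_cancel] at h2
      linarith
  have hlim : Tendsto (fun s => lfppExponent h P ξ - (ξ - ζ) * (s - ζ)) (𝓝[>] b)
      (𝓝 (lfppExponent h P ξ - (ξ - ζ) * (b - ζ))) :=
    (Continuous.tendsto (by fun_prop) _).mono_left nhdsWithin_le_nhds
  have := le_of_tendsto hlim (eventually_nhdsWithin_of_forall key)
  linarith

end exponent

/-! ### Passage to derivatives. -/

lemma HasDerivAt.le_of_forall_gt_le {f g : ℝ → ℝ} {x f' g' : ℝ} (hf : HasDerivAt f f' x)
    (hg : HasDerivAt g g' x) (heq : f x = g x) (hle : ∀ y, x < y → f y ≤ g y) : f' ≤ g' := by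
  refine le_of_tendsto_of_tendsto (hf.tendsto_slope.mono_left (nhdsGT_le_nhdsNE x))
    (hg.tendsto_slope.mono_left (nhdsGT_le_nhdsNE x))
    (eventually_nhdsWithin_of_forall fun y hy => ?_)
  have hy' : 0 < y - x := sub_pos.mpr hy
  rw [slope_def_field, slope_def_field, heq]
  gcongr
  exact hle y hy

theorem lemma1p5 {d : ℕ} (hd : 3 ≤ d) {Ω : Type*} [MeasurableSpace Ω] (P : Measure Ω)
    [IsProbabilityMeasure P] (h : Measure (EuclideanSpace ℝ (Fin d)) → Ω → ℝ) (hh : IsLGF h P) :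
    (∀ ξ : ℝ, 0 ≤ ξ → IsLUB (lfppExponentSet h P ξ) (lfppExponent h P ξ)) ∧
    LipschitzOnWith (NNReal.sqrt (2 * d)) (lfppExponent h P) (Set.Ici 0) ∧
    ∀ᵐ ξ ∂(volume.restrict (Set.Ici (0 : ℝ))),
      DifferentiableAt ℝ (lfppExponent h P) ξ ∧
      max (-ξ) (1 / ξ * (lfppExponent h P ξ - 1)) ≤ deriv (lfppExponent h P) ξ ∧
      deriv (lfppExponent h P) ξ ≤
        √(2 * ((d : ℝ) - 1) + 2 * lfppExponent h P ξ + ξ ^ 2) - ξ := by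
  have hd2 : 2 ≤ d := by omega
  have hlip := hh.lipschitzWith_lfppExponent hd2
  refine ⟨fun ξ _ => hh.isLUB_lfppExponent hd2 ξ, hlip.lipschitzOnWith, ?_⟩
  -- The Lipschitz bound holds on all of `ℝ`, so Rademacher's theorem gives two-sided derivatives.
  -- The null set `{0}` is dropped because one comparison divides by `ξ`.
  filter_upwards [ae_restrict_of_ae hlip.ae_differentiableAt_real, ae_restrict_mem measurableSet_Ici,
    ae_restrict_of_ae (Measure.ae_ne volume (0 : ℝ))] with ξ hdiff hξ0 hξne
  have hξ : 0 < ξ := lt_of_le_of_ne hξ0 hξne.symm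
  have hderiv := hdiff.hasDerivAt
  refine ⟨hdiff, max_le ?_ ?_, ?_⟩
  · refine HasDerivAt.le_of_forall_gt_le
      (f := fun ζ => lfppExponent h P ξ - (ζ ^ 2 - ξ ^ 2) / 2) ?_ hderiv (by simp)
      fun ζ hζ => hh.sub_sq_le_lfppExponent hd2 hξ.le hζ
    have := ((((hasDerivAt_id ξ).pow 2).sub_const (ξ ^ 2)).div_const 2).const_sub
      (lfppExponent h P ξ)
    refine this.congr_deriv ?_
    simp
  · refine HasDerivAt.le_of_forall_gt_le
      (f := fun ζ => 1 + ζ / ξ * (lfppExponent h P ξ - 1)) ?_ hderiv ?_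
      fun ζ hζ => hh.one_add_div_mul_le_lfppExponent hd2 hξ hζ
    · exact (((hasDerivAt_id ξ).div_const ξ).mul_const _).const_add 1
    · simp [hξne]
  · refine hderiv.le_of_forall_gt_le (g := fun ζ => lfppExponent h P ξ + (ζ - ξ) *
      (√(2 * ((d : ℝ) - 1) + 2 * lfppExponent h P ξ + ξ ^ 2) - ξ)) ?_ (by simp)
      fun ζ hζ => hh.lfppExponent_le_add_mul hd2 hζ
    have := (((hasDerivAt_id ξ).sub_const ξ).mul_const
      (√(2 * ((d : ℝ) - 1) + 2 * lfppExponent h P ξ + ξ ^ 2) - ξ)).const_add (lfppExponent h P ξ)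
    rwa [one_mul] at this
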